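/- **Definitions.** For a convex body $K\subset\mathbb{R}^n$ (compact, convex, nonempty interior) let $h_K(v)=\max_{y\in K}\langle v,y\rangle$ be its support function, let $\partial'K$ be the set of boundary points $x$ of $K$ for which there is exactly one $v\in\mathbb{S}^{n-1}$ with $\langle x,v\rangle=h_K(v)$, and let $\nu_K:\partial'K\to\mathbb{S}^{n-1}$ map $x$ to this $v$. Let $\mathcal{K}_e^n$ be the set of origin-symmetric convex bodies in $\mathbb{R}^n$. For $K\in\mathcal{K}_e^n$, real $p,q>1$ and Borel $\eta\subset\mathbb{S}^{n-1}$ put $$\widetilde V_{\gamma_n,q}(K)=\int_K e^{-\frac{|x|^2}{2}}|x|^{q-n}\,dx,\qquad \widetilde C_{p,\gamma_n,q}(K,\eta)=\int_{\nu_K^{-1}(\eta)}\langle x,\nu_K(x)\rangle^{1-p}|x|^{q-n}e^{-\frac{|x|^2}{2}}\,d\mathcal{H}^{n-1}(x).$$ For a finite Borel measure $\mu$ on $\mathbb{S}^{n-1}$ write $|\mu|=\mu(\mathbb{S}^{n-1})$, and likewise $|\widetilde C_{p,\gamma_n,q}(K,\cdot)|$ for the total mass of $\widetilde C_{p,\gamma_n,q}(K,\cdot)$.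 **Theorem 4.1.** Let $p,q>1$ and let $\mu$ be a nonzero finite Borel measure on $\mathbb{S}^{n-1}$ that is even, i.e. $\mu(-\eta)=\mu(\eta)$ for every Borel set $\eta$. Suppose that $K_0\in\mathcal{K}_e^n$ satisfies $\widetilde V_{\gamma_n,q}(K_0)=|\mu|$ and maximizes $$\Phi(K)=-\frac{1}{p|\mu|}\int_{\mathbb{S}^{n-1}}h_K(v)^p\,d\mu(v)$$ among all $K\in\mathcal{K}_e^n$ with $\widetilde V_{\gamma_n,q}(K)=|\mu|$. Then $$\frac{\mu}{|\mu|}=\frac{\widetilde C_{p,\gamma_n,q}(K_0,\cdot)}{|\widetilde C_{p,\gamma_n,q}(K_0,\cdot)|}.$$ -/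

import Mathlib

open MeasureTheory
open scoped RealInnerProductSpace ENNReal

namespace GaussianDual

variable {n : ℕ}

/-- Support function `h_K(v) = max {⟨v, y⟩ : y ∈ K}`; the supremum is attained as `K` is compact and
nonempty. -/
noncomputable def supportFunction (K : ConvexBody (EuclideanSpace ℝ (Fin n)))
    (v : EuclideanSpace ℝ (Fin n)) : ℝ :=
  sSup ((fun y => ⟪v, y⟫) '' (K : Set (EuclideanSpace ℝ (Fin n))))

/-- The origin-symmetric convex bodies of `ℝⁿ` (compact, convex, with nonempty interior). -/
def symmetricBodies (n : ℕ) : Set (ConvexBody (EuclideanSpace ℝ (Fin n))) :=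
  {K | (interior (K : Set (EuclideanSpace ℝ (Fin n)))).Nonempty ∧ ∀ x ∈ K, -x ∈ K}

/-- The `q`-th Gaussian dual quermassintegral `∫_K exp(-|x|²/2) |x|^(q-n) dx`, the integral being with
respect to Lebesgue measure. -/
noncomputable def dualQuermassintegral (q : ℝ) (K : ConvexBody (EuclideanSpace ℝ (Fin n))) : ℝ≥0∞ :=
  ∫⁻ x in (K : Set (EuclideanSpace ℝ (Fin n))),
    ENNReal.ofReal (Real.exp (-‖x‖ ^ 2 / 2) * ‖x‖ ^ (q - n))

/-- The regular boundary `∂'K`: the points of `∂K` that lie in the supporting hyperplane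
`H_K(v) = {x | ⟨x, v⟩ = h_K(v)}` of exactly one unit vector `v`. -/
def regularBoundary (K : ConvexBody (EuclideanSpace ℝ (Fin n))) :
    Set (EuclideanSpace ℝ (Fin n)) :=
  {x | x ∈ frontier (K : Set (EuclideanSpace ℝ (Fin n))) ∧
    ∃! v : Metric.sphere (0 : EuclideanSpace ℝ (Fin n)) 1,
      ⟪x, (v : EuclideanSpace ℝ (Fin n))⟫ = supportFunction K v}

/-- The Gauss map `ν_K : ∂'K → S^{n-1}`. -/
noncomputable def gaussMap (K : ConvexBody (EuclideanSpace ℝ (Fin n))) (x : regularBoundary K) :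
    Metric.sphere (0 : EuclideanSpace ℝ (Fin n)) 1 :=
  x.2.2.choose

/-- The `L_p` Gaussian dual curvature measure on `S^{n-1}`: the push-forward under `ν_K` of the measure
with density `⟨x, ν_K(x)⟩^(1-p) |x|^(q-n) exp(-|x|²/2)` with respect to `(n-1)`-dimensional Hausdorff
measure on `∂'K` (normalized as surface area; the Hausdorff measure of the subspace `∂'K` is the
restriction of that of `ℝⁿ`). -/
noncomputable def dualCurvatureMeasure (p q : ℝ) (K : ConvexBody (EuclideanSpace ℝ (Fin n))) :
    Measure (Metric.sphere (0 : EuclideanSpace ℝ (Fin n)) 1) :=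
  Measure.map (gaussMap K)
    ((Measure.euclideanHausdorffMeasure (n - 1) : Measure (regularBoundary K)).withDensity fun x =>
      ENNReal.ofReal
        (⟪(x : EuclideanSpace ℝ (Fin n)), (gaussMap K x : EuclideanSpace ℝ (Fin n))⟫ ^ (1 - p) *
          ‖(x : EuclideanSpace ℝ (Fin n))‖ ^ (q - n) *
          Real.exp (-‖(x : EuclideanSpace ℝ (Fin n))‖ ^ 2 / 2)))

/-- The functional `Φ(K) = -(∫ h_K^p dμ) / (p |μ|)`. -/
noncomputable def functionalPhi (p : ℝ)
    (μ : Measure (Metric.sphere (0 : EuclideanSpace ℝ (Fin n)) 1))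
    (K : ConvexBody (EuclideanSpace ℝ (Fin n))) : ℝ :=
  -(∫ v, supportFunction K v ^ p ∂μ) / (p * μ.real Set.univ)

theorem continuous_supportFunction (K : ConvexBody (EuclideanSpace ℝ (Fin n))) :
    Continuous (supportFunction K) := by
  unfold supportFunction
  exact K.isCompact.continuous_sSup (by fun_prop)

/-- The Gauss map is continuous, so that the push-forward above is a genuine one. -/
theorem continuous_gaussMap (K : ConvexBody (EuclideanSpace ℝ (Fin n))) :
    Continuous (gaussMap K) := by
  rw [continuous_iff_isClosed]
  intro s hs
  have hc := continuous_supportFunction K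
  have hclosed : IsClosed {z : regularBoundary K × Metric.sphere (0 : EuclideanSpace ℝ (Fin n)) 1 |
      ⟪(z.1 : EuclideanSpace ℝ (Fin n)), (z.2 : EuclideanSpace ℝ (Fin n))⟫ =
        supportFunction K z.2 ∧ z.2 ∈ s} := by
    rw [Set.ofPred_and]
    exact (isClosed_eq (by fun_prop) (by fun_prop)).inter (hs.preimage continuous_snd)
  have himage := isClosedMap_fst_of_compactSpace _ hclosed
  convert himage using 1
  ext x
  have hx := x.2.2.choose_spec
  constructor
  · exact fun h => ⟨(x, gaussMap K x), ⟨hx.1, h⟩, rfl⟩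
  · rintro ⟨⟨y, v⟩, ⟨h1, h2⟩, rfl⟩
    have hv : v = gaussMap K y := hx.2 v h1
    exact hv ▸ h2

/-- The curvature measure of `η` is the integral of the density over `ν_K⁻¹(η)`. -/
theorem dualCurvatureMeasure_apply (p q : ℝ) (K : ConvexBody (EuclideanSpace ℝ (Fin n)))
    {η : Set (Metric.sphere (0 : EuclideanSpace ℝ (Fin n)) 1)} (hη : MeasurableSet η) :
    dualCurvatureMeasure p q K η = ∫⁻ x in gaussMap K ⁻¹' η,
      ENNReal.ofReal
        (⟪(x : EuclideanSpace ℝ (Fin n)), (gaussMap K x : EuclideanSpace ℝ (Fin n))⟫ ^ (1 - p) *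
          ‖(x : EuclideanSpace ℝ (Fin n))‖ ^ (q - n) *
          Real.exp (-‖(x : EuclideanSpace ℝ (Fin n))‖ ^ 2 / 2))
      ∂(Measure.euclideanHausdorffMeasure (n - 1) : Measure (regularBoundary K)) := by
  rw [dualCurvatureMeasure, Measure.map_apply (continuous_gaussMap K).measurable hη,
    withDensity_apply _ ((continuous_gaussMap K).measurable hη)]

end GaussianDual

/-! ### Volumes of cones over flat and almost flat sets -/

namespace GaussianDual

open Set Module
open scoped NNReal Pointwise

/-! The proof is a variational argument on support functions. Write `h` for the support function of
the maximizer `K` on the sphere, and for an even continuous `g` let `K_t` be the Wulff shape of `h +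
t g`. By polar coordinates the Gaussian dual volume is the integral over directions `u` of a
primitive evaluated at the radial function `ρ(u)`; the weight `|x|^(q-n)` turns the polar Jacobian
into `r^(q-1)`. Aleksandrov's lemma (`hasDerivAt_wulffRadial`) says that at a direction whose
boundary point has a single normal `v` the radial function varies at rate `ρ g(v) / h(v)`. Almost
every direction is of this kind, by Rademacher's theorem applied to the gauge. Hence the volume of
`K_t` has derivative `D(g)`, the integral of `g` against the curvature measure with `p = 1`, while
`∫ (h + t g)^p dμ` has derivative `p S(g)` with `S(g) = ∫ g h^(p-1) dμ`.

No Lagrange multiplier theorem is needed. A competitor with too much volume can be scaled down to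
the prescribed volume, which only lowers its support function. So `D(g) > 0` forces `S(g) ≥ 0`.
Since `D(h) > 0`, linearity upgrades this implication to the proportionality `D(h) S(g) = S(h)
D(g)`. Both measures are even, so testing on even functions identifies `D(h) h^(p-1) μ` with `S(h)`
times the curvature measure for `p = 1`. Multiplying by `h^(1-p)` gives the curvature measure for
`p`, and normalizing total masses finishes.

The geometric input is the change of variables from the boundary to the sphere: radial projection
carries `h(ν) dH^(n-1)` to `ρ^n du` (`map_boundaryDirection_supportSurfaceMeasure`). Both sides are
`n` times the volume of the cone over a boundary patch. For a patch in a hyperplane this is the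
elementary formula base times height. A patch whose normals all lie near `v₀` is nearly isometric to
its projection on the supporting hyperplane of `v₀`, and so are the cones, with a Lipschitz factor
`L` as close to 1 as desired. Covering the sphere of normals by finitely many balls and letting `L`
tend to 1 gives equality, without any area formula for Lipschitz graphs. -/

theorem euclideanHausdorffMeasure_image_le_of_dist_le {ι X Y : Type*} [MetricSpace X]
    [MeasurableSpace X] [BorelSpace X] [MetricSpace Y] [MeasurableSpace Y] [BorelSpace Y]
    {f : ι → X} {g : ι → Y} {I : Set ι} {L : ℝ≥0} (d : ℕ)
    (h : ∀ i ∈ I, ∀ j ∈ I, dist (f i) (f j) ≤ L * dist (g i) (g j)) :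
    μHE[d] (f '' I) ≤ (L : ℝ≥0∞) ^ d * μHE[d] (g '' I) := by
  rcases I.eq_empty_or_nonempty with rfl | ⟨i₀, -⟩
  · simp
  have : Nonempty ι := ⟨i₀⟩
  -- The hypothesis makes `f ∘ g⁻¹` well defined and `L`-Lipschitz on `g '' I`, whichever preimages
  -- are chosen.
  have hlip : LipschitzOnWith L (f ∘ Function.invFunOn g I) (g '' I) := by
    refine LipschitzOnWith.of_dist_le_mul fun x hx y hy => ?_
    have := h _ (Function.invFunOn_mem hx) _ (Function.invFunOn_mem hy)
    rwa [Function.invFunOn_eq hx, Function.invFunOn_eq hy] at this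
  have hsub : f '' I ⊆ (f ∘ Function.invFunOn g I) '' (g '' I) := by
    rintro _ ⟨i, hi, rfl⟩
    refine ⟨g i, mem_image_of_mem g hi, ?_⟩
    have hx : ∃ j ∈ I, g j = g i := ⟨i, hi, rfl⟩
    have := h _ (Function.invFunOn_mem hx) _ hi
    rw [Function.invFunOn_eq hx, dist_self, mul_zero] at this
    exact dist_le_zero.1 this
  refine (measure_mono hsub).trans ?_
  have := hlip.hausdorffMeasure_image_le (d := d) (by positivity)
  simp only [Measure.euclideanHausdorffMeasure_def, Measure.smul_apply, ENNReal.smul_def,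
    smul_eq_mul, ENNReal.rpow_natCast] at this ⊢
  rw [mul_left_comm]
  gcongr

variable {E : Type*} [NormedAddCommGroup E] [InnerProductSpace ℝ E] [FiniteDimensional ℝ E]
  [MeasurableSpace E] [BorelSpace E]

theorem measurableSet_Ioo_smul {A : Set E} (hA : MeasurableSet A)
    (hinj : ∀ x ∈ A, ∀ y ∈ A, ∀ r : ℝ, 0 < r → r • x = y → r = 1) :
    MeasurableSet (Ioo (0 : ℝ) 1 • A) := by
  have : Ioo (0 : ℝ) 1 • A = (fun z : ℝ × E => z.1 • z.2) '' (Ioo (0 : ℝ) 1 ×ˢ A) := by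
    rw [image_prod, image2_smul]
  rw [this]
  refine (measurableSet_Ioo.prod hA).image_of_continuousOn_injOn (by fun_prop) ?_
  rintro ⟨s, x⟩ ⟨hs, hx⟩ ⟨t, y⟩ ⟨ht, hy⟩ (hxy : s • x = t • y)
  simp only [mem_Ioo] at hs ht hx hy
  have h1 : (s / t) • x = y := by
    rw [div_eq_inv_mul, mul_smul, hxy, smul_smul, inv_mul_cancel₀ ht.1.ne', one_smul]
  have h2 := hinj x hx y hy _ (div_pos hs.1 ht.1) h1
  rw [h2, one_smul] at h1
  rw [div_eq_one_iff_eq ht.1.ne'] at h2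
  rw [h1, h2]

/-- Slicing by hyperplanes orthogonal to `v`: the slice at height `x ∈ (0, c)` is `(x / c) • B`, and
the integral of `(x / c) ^ (n - 1)` over this interval is `c / n`. -/
theorem volume_Ioo_smul_of_inner_eq {v : E} (hv : ‖v‖ = 1) {c : ℝ} (hc : 0 < c) {B : Set E}
    (hB : MeasurableSet B) (hBv : ∀ x ∈ B, ⟪x, v⟫ = c) :
    finrank ℝ E * volume (Ioo (0 : ℝ) 1 • B) =
      ENNReal.ofReal c * μHE[finrank ℝ E - 1] B := by
  have hv0 : v ≠ 0 := by rintro rfl; simp at hv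
  have hn : 0 < finrank ℝ E := finrank_pos_iff_exists_ne_zero.2 ⟨v, hv0⟩
  have hm : MeasurableSet (Ioo (0 : ℝ) 1 • B) := by
    refine measurableSet_Ioo_smul hB fun x hx y hy r _ hxy => ?_
    have := hBv y hy
    rw [← hxy, real_inner_smul_left, hBv x hx] at this
    exact mul_right_cancel₀ hc.ne' (by rw [this, one_mul])
  have hslice (x : ℝ) : Ioo (0 : ℝ) 1 • B ∩ AffineSubspace.mk' (x • v +ᵥ (0 : E)) (ℝ ∙ v)ᗮ =
      if x ∈ Ioo 0 c then (x / c) • B else ∅ := by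
    ext y
    have hmem : y ∈ (AffineSubspace.mk' (x • v +ᵥ (0 : E)) (ℝ ∙ v)ᗮ : Set E) ↔ ⟪y, v⟫ = x := by
      rw [SetLike.mem_coe, AffineSubspace.mem_mk', Submodule.mem_orthogonal_singleton_iff_inner_left]
      simp [inner_sub_left, real_inner_smul_left, hv, sub_eq_zero]
    rw [mem_inter_iff, hmem]
    constructor
    · rintro ⟨⟨s, hs, z, hz, rfl⟩, h⟩
      simp only [real_inner_smul_left, hBv z hz] at h
      have hx : x ∈ Ioo 0 c := by
        rw [← h]; exact ⟨mul_pos hs.1 hc, by nlinarith [hs.2]⟩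
      rw [if_pos hx]
      refine ⟨z, hz, ?_⟩
      simp [← h, hc.ne']
    · split_ifs with hx
      · rintro ⟨z, hz, rfl⟩
        refine ⟨⟨x / c, ⟨div_pos hx.1 hc, (div_lt_one hc).2 hx.2⟩, z, hz, rfl⟩, ?_⟩
        simp only [real_inner_smul_left, hBv z hz]
        field_simp
      · simp
  have hmeas (x : ℝ) : μHE[finrank ℝ E - 1]
      (Ioo (0 : ℝ) 1 • B ∩ AffineSubspace.mk' (x • v +ᵥ (0 : E)) (ℝ ∙ v)ᗮ) =
      (Ioo 0 c).indicator (fun x => ENNReal.ofReal ((x / c) ^ (finrank ℝ E - 1))) x *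
        μHE[finrank ℝ E - 1] B := by
    rw [hslice]
    by_cases hx : x ∈ Ioo 0 c
    · have hxc : 0 < x / c := div_pos hx.1 hc
      rw [if_pos hx, indicator_of_mem hx,
        Measure.euclideanHausdorffMeasure_smul₀ _ hxc.ne', ENNReal.smul_def, smul_eq_mul,
        ENNReal.ofReal_pow hxc.le]
      rw [← Real.enorm_eq_ofReal hxc.le, ENNReal.coe_pow]
      rfl
    · simp [hx]
  have hint : ∫⁻ x, (Ioo 0 c).indicator
      (fun x => ENNReal.ofReal ((x / c) ^ (finrank ℝ E - 1))) x =
      ENNReal.ofReal (c / finrank ℝ E) := by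
    rw [lintegral_indicator measurableSet_Ioo, Measure.restrict_congr_set Ioo_ae_eq_Ioc,
      ← ofReal_integral_eq_lintegral_ofReal, ← intervalIntegral.integral_of_le hc.le]
    · congr 1
      simp only [div_pow]
      rw [intervalIntegral.integral_div, integral_pow]
      have : finrank ℝ E - 1 + 1 = finrank ℝ E := by omega
      rw [this]
      have h2 : ((finrank ℝ E - 1 : ℕ) : ℝ) + 1 = finrank ℝ E := by exact_mod_cast this
      rw [h2, zero_pow hn.ne', sub_zero]
      nth_rw 1 [← this]
      rw [pow_succ]
      field_simp
    · exact (Continuous.integrableOn_Ioc (by fun_prop))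
    · filter_upwards [ae_restrict_mem measurableSet_Ioc] with y hy
      exact pow_nonneg (div_nonneg hy.1.le hc.le) _
  rw [← InnerProductSpace.euclideanHausdorffMeasure_eq_volume,
    EuclideanGeometry.euclideanHausdorffMeasure_eq_lintegral (0 : E) hv0 hm]
  simp_rw [hmeas]
  rw [lintegral_mul_const _ (by measurability), hint, ← mul_assoc, ← mul_assoc]
  congr 1
  have : ‖v‖ₑ = 1 := by rw [← ofReal_norm, hv, ENNReal.ofReal_one]
  rw [this, mul_one, ← ENNReal.ofReal_natCast, ← ENNReal.ofReal_mul (by positivity)]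
  congr 1
  field_simp

end GaussianDual

namespace GaussianDual

open Set Module
open scoped NNReal Pointwise

variable {E : Type*} [NormedAddCommGroup E] [InnerProductSpace ℝ E] [FiniteDimensional ℝ E]
  [MeasurableSpace E] [BorelSpace E]

/-- The orthogonal projection onto the hyperplane `{x | ⟪x, v⟫ = c}`, for a unit vector `v`. -/
noncomputable def hyperplaneProj (v : E) (c : ℝ) (x : E) : E := x + (c - ⟪x, v⟫) • v

-- Projecting a nearly flat patch onto the hyperplane changes differences of points of its cone by a
-- small relative error. The error is a multiple of `v` whose coefficient involves only `s - t` and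
-- the tilt `⟪x - y, v⟫`, so it suffices to bound `|s - t|` by the distance `‖z‖` of the two cone
-- points.
omit [FiniteDimensional ℝ E] [MeasurableSpace E] [BorelSpace E] in
theorem norm_smul_hyperplaneProj_sub_le {v : E} (hv : ‖v‖ = 1) {c R δ : ℝ} (hc : 0 < c)
    (hR : 0 ≤ R) (hδ : 0 ≤ δ) (hδ1 : δ ≤ 1) (hδc : δ * (1 + R) ≤ c / 2) {x y : E}
    (hxR : ‖x‖ ≤ R) (hxc : |⟪x, v⟫ - c| ≤ δ)
    (hxy : |⟪x - y, v⟫| ≤ δ * ‖x - y‖) (s t : ℝ) :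
    ‖(s • hyperplaneProj v c x - t • hyperplaneProj v c y) - (s • x - t • y)‖ ≤
      δ * (4 * (1 + R) / c + 1) * ‖s • x - t • y‖ := by
  have e1 : (s • hyperplaneProj v c x - t • hyperplaneProj v c y) - (s • x - t • y) =
      ((s - t) * (c - ⟪x, v⟫) - t * ⟪x - y, v⟫) • v := by
    simp only [hyperplaneProj, smul_add, smul_smul, inner_sub_left]
    module
  set z := s • x - t • y with hz
  have e2 : ‖t • (x - y)‖ ≤ R * |s - t| + ‖z‖ := by
    have : t • (x - y) = (t - s) • x + z := by rw [hz]; module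
    rw [this]
    refine (norm_add_le _ _).trans ?_
    rw [norm_smul, Real.norm_eq_abs, abs_sub_comm t s, mul_comm R]
    gcongr
  have e3 : |t * ⟪x - y, v⟫| ≤ δ * (R * |s - t| + ‖z‖) := by
    rw [abs_mul]
    calc |t| * |⟪x - y, v⟫| ≤ |t| * (δ * ‖x - y‖) := by gcongr
      _ = δ * ‖t • (x - y)‖ := by rw [norm_smul, Real.norm_eq_abs]; ring
      _ ≤ _ := by gcongr
  have e4 : |⟪z, v⟫| ≤ ‖z‖ := by simpa [hv] using abs_real_inner_le_norm z v
  have e5 : (s - t) * ⟪x, v⟫ = ⟪z, v⟫ - t * ⟪x - y, v⟫ := by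
    rw [hz]; simp only [inner_sub_left, real_inner_smul_left]; ring
  -- The component of `z` along `v` is `(s - t) * ⟪x, v⟫` up to the tilt term, and `⟪x, v⟫ ≥ c - δ`.
  -- As `δ * (1 + R) ≤ c / 2`, the terms in `|s - t|` can be absorbed on the left.
  have e6 : |s - t| * (c - δ) ≤ ‖z‖ + δ * (R * |s - t| + ‖z‖) := by
    have h1 : c - δ ≤ |⟪x, v⟫| := by
      have := (abs_le.1 hxc).1
      exact (by linarith : c - δ ≤ ⟪x, v⟫).trans (le_abs_self _)
    calc |s - t| * (c - δ) ≤ |s - t| * |⟪x, v⟫| := by gcongr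
      _ = |⟪z, v⟫ - t * ⟪x - y, v⟫| := by rw [← abs_mul, e5]
      _ ≤ |⟪z, v⟫| + |t * ⟪x - y, v⟫| := abs_sub _ _
      _ ≤ _ := add_le_add e4 e3
  have hz0 := norm_nonneg z
  have hst := abs_nonneg (s - t)
  have e7 : |s - t| ≤ 4 / c * ‖z‖ := by
    rw [div_mul_eq_mul_div, le_div_iff₀ hc]
    have : |s - t| * (c / 2) ≤ 2 * ‖z‖ := by nlinarith
    linarith
  rw [e1, norm_smul, hv, mul_one, Real.norm_eq_abs]
  calc |(s - t) * (c - ⟪x, v⟫) - t * ⟪x - y, v⟫|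
      ≤ |(s - t) * (c - ⟪x, v⟫)| + |t * ⟪x - y, v⟫| := abs_sub _ _
    _ ≤ |s - t| * δ + δ * (R * |s - t| + ‖z‖) := by
        refine add_le_add ?_ e3
        rw [abs_mul, abs_sub_comm c]
        gcongr
    _ = δ * ((1 + R) * |s - t| + ‖z‖) := by ring
    _ ≤ δ * ((1 + R) * (4 / c * ‖z‖) + ‖z‖) := by gcongr
    _ = _ := by ring

/-- The projection to the hyperplane is bi-Lipschitz with constant `L` both on the patch and on its
cone, so the exact formula for the flat cone transfers at the cost of powers of `L`. -/
theorem exists_cone_comparison {v : E} (hv : ‖v‖ = 1) {c R : ℝ} (hc : 0 < c) (hR : 0 ≤ R)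
    {L : ℝ≥0} (hL : 1 < L) : ∃ δ > 0, ∀ A : Set E, MeasurableSet A →
      (∀ x ∈ A, ‖x‖ ≤ R) → (∀ x ∈ A, |⟪x, v⟫ - c| ≤ δ) →
      (∀ x ∈ A, ∀ y ∈ A, |⟪x - y, v⟫| ≤ δ * ‖x - y‖) →
      finrank ℝ E * volume (Ioo (0 : ℝ) 1 • A) ≤
        (L : ℝ≥0∞) ^ (2 * finrank ℝ E) * (ENNReal.ofReal c * μHE[finrank ℝ E - 1] A) ∧
      ENNReal.ofReal c * μHE[finrank ℝ E - 1] A ≤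
        (L : ℝ≥0∞) ^ (2 * finrank ℝ E) * (finrank ℝ E * volume (Ioo (0 : ℝ) 1 • A)) := by
  have hL' : (1 : ℝ) < L := by exact_mod_cast hL
  have hL0 : (0 : ℝ) < L := by linarith
  set M := 4 * (1 + R) / c + 1 with hM
  have hM0 : 0 < M := by positivity
  -- The last term makes the relative error at most `1 - 1 / L`. Then lengths shrink by a factor at
  -- least `1 / L` and grow by at most `2 - 1 / L ≤ L`.
  set δ := min (min 1 (c / 2 / (1 + R))) ((1 - 1 / (L : ℝ)) / M) with hδ
  have h1L : 0 < 1 - 1 / (L : ℝ) := by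
    rw [sub_pos, div_lt_one hL0]; exact hL'
  have hδ0 : 0 < δ := by positivity
  have hδ1 : δ ≤ 1 := (min_le_left _ _).trans (min_le_left _ _)
  have hδc : δ * (1 + R) ≤ c / 2 := by
    rw [← le_div_iff₀ (by positivity)]
    exact (min_le_left _ _).trans (min_le_right _ _)
  have hδM : δ * M ≤ 1 - 1 / (L : ℝ) := by
    rw [← le_div_iff₀ hM0]; exact min_le_right _ _
  refine ⟨δ, hδ0, fun A hA hAR hAc hAv => ?_⟩
  set Q := hyperplaneProj v c with hQ
  have key : ∀ x ∈ A, ∀ y ∈ A, ∀ s t : ℝ,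
      dist (s • Q x) (t • Q y) ≤ L * dist (s • x) (t • y) ∧
      dist (s • x) (t • y) ≤ L * dist (s • Q x) (t • Q y) := by
    intro x hx y hy s t
    have h := norm_smul_hyperplaneProj_sub_le hv hc hR hδ0.le hδ1 hδc (hAR x hx) (hAc x hx)
      (hAv x hx y hy) s t
    rw [← hQ, ← hM] at h
    have h' := h.trans (mul_le_mul_of_nonneg_right hδM (norm_nonneg _))
    rw [dist_eq_norm, dist_eq_norm]
    set z := s • x - t • y
    set z' := s • Q x - t • Q y
    have hz := norm_nonneg z
    have t1 : ‖z'‖ ≤ ‖z' - z‖ + ‖z‖ := by simpa using norm_add_le (z' - z) z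
    have t2 : ‖z‖ ≤ ‖z' - z‖ + ‖z'‖ := by
      simpa [norm_sub_rev] using norm_add_le (z - z') z'
    constructor
    · have : (1 - 1 / (L : ℝ)) + 1 ≤ L := by
        have : 0 ≤ ((L : ℝ) - 1) ^ 2 / L := by positivity
        have e : ((L : ℝ) - 1) ^ 2 / L = L - 2 + 1 / L := by field_simp; ring
        linarith
      calc ‖z'‖ ≤ ((1 - 1 / (L : ℝ)) + 1) * ‖z‖ := by linarith
        _ ≤ L * ‖z‖ := by gcongr
    · have : 1 / (L : ℝ) * ‖z‖ ≤ ‖z'‖ := by linarith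
      rw [one_div, inv_mul_le_iff₀ hL0] at this
      exact this
  have key1 : ∀ x ∈ A, ∀ y ∈ A,
      dist (Q x) (Q y) ≤ L * dist x y ∧ dist x y ≤ L * dist (Q x) (Q y) := by
    intro x hx y hy
    simpa using key x hx y hy 1 1
  have hQinj : InjOn Q A := fun x hx y hy hxy => by
    have := (key1 x hx y hy).2
    rw [hxy, dist_self, mul_zero] at this
    exact dist_le_zero.1 this
  have hB : MeasurableSet (Q '' A) :=
    hA.image_of_continuousOn_injOn (by unfold Q hyperplaneProj; fun_prop) hQinj
  have hBv : ∀ x ∈ Q '' A, ⟪x, v⟫ = c := by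
    rintro _ ⟨x, -, rfl⟩
    simp [hQ, hyperplaneProj, inner_add_left, real_inner_smul_left, hv]
  have hflat := volume_Ioo_smul_of_inner_eq hv hc hB hBv
  have hcA : Ioo (0 : ℝ) 1 • A = (fun z : ℝ × E => z.1 • z.2) '' (Ioo (0 : ℝ) 1 ×ˢ A) := by
    rw [image_prod, image2_smul]
  have hcB : Ioo (0 : ℝ) 1 • (Q '' A) =
      (fun z : ℝ × E => z.1 • Q z.2) '' (Ioo (0 : ℝ) 1 ×ˢ A) := by
    rw [← image2_smul, image2_image_right, ← image_prod]
  have b1 : μHE[finrank ℝ E - 1] (Q '' A) ≤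
      (L : ℝ≥0∞) ^ (finrank ℝ E - 1) * μHE[finrank ℝ E - 1] A := by
    simpa using euclideanHausdorffMeasure_image_le_of_dist_le (f := Q) (g := id) (I := A)
      (finrank ℝ E - 1) fun x hx y hy => (key1 x hx y hy).1
  have b2 : μHE[finrank ℝ E - 1] A ≤
      (L : ℝ≥0∞) ^ (finrank ℝ E - 1) * μHE[finrank ℝ E - 1] (Q '' A) := by
    simpa using euclideanHausdorffMeasure_image_le_of_dist_le (f := id) (g := Q) (I := A)
      (finrank ℝ E - 1) fun x hx y hy => (key1 x hx y hy).2
  -- Both cones are parametrized by the same pairs `(s, x)`, and volume is the `n`-dimensional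
  -- Hausdorff measure, so the Lipschitz comparison applies to them as well.
  have b3 : volume (Ioo (0 : ℝ) 1 • (Q '' A)) ≤
      (L : ℝ≥0∞) ^ finrank ℝ E * volume (Ioo (0 : ℝ) 1 • A) := by
    rw [hcA, hcB, ← InnerProductSpace.euclideanHausdorffMeasure_eq_volume]
    exact euclideanHausdorffMeasure_image_le_of_dist_le _
      fun x hx y hy => (key _ hx.2 _ hy.2 _ _).1
  have b4 : volume (Ioo (0 : ℝ) 1 • A) ≤
      (L : ℝ≥0∞) ^ finrank ℝ E * volume (Ioo (0 : ℝ) 1 • (Q '' A)) := by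
    rw [hcA, hcB, ← InnerProductSpace.euclideanHausdorffMeasure_eq_volume]
    exact euclideanHausdorffMeasure_image_le_of_dist_le _
      fun x hx y hy => (key _ hx.2 _ hy.2 _ _).2
  have hL1 : (1 : ℝ≥0∞) ≤ L := by exact_mod_cast hL.le
  have hpow : (L : ℝ≥0∞) ^ finrank ℝ E * (L : ℝ≥0∞) ^ (finrank ℝ E - 1) ≤
      (L : ℝ≥0∞) ^ (2 * finrank ℝ E) := by
    rw [← pow_add]
    exact pow_le_pow_right₀ hL1 (by omega)
  constructor
  · calc (finrank ℝ E : ℝ≥0∞) * volume (Ioo (0 : ℝ) 1 • A)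
        ≤ finrank ℝ E * ((L : ℝ≥0∞) ^ finrank ℝ E * volume (Ioo (0 : ℝ) 1 • (Q '' A))) := by
          gcongr
      _ = (L : ℝ≥0∞) ^ finrank ℝ E * (ENNReal.ofReal c * μHE[finrank ℝ E - 1] (Q '' A)) := by
          rw [← hflat]; ring
      _ ≤ (L : ℝ≥0∞) ^ finrank ℝ E * (ENNReal.ofReal c *
            ((L : ℝ≥0∞) ^ (finrank ℝ E - 1) * μHE[finrank ℝ E - 1] A)) := by gcongr
      _ = ((L : ℝ≥0∞) ^ finrank ℝ E * (L : ℝ≥0∞) ^ (finrank ℝ E - 1)) *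
            (ENNReal.ofReal c * μHE[finrank ℝ E - 1] A) := by ring
      _ ≤ _ := by gcongr
  · calc ENNReal.ofReal c * μHE[finrank ℝ E - 1] A
        ≤ ENNReal.ofReal c * ((L : ℝ≥0∞) ^ (finrank ℝ E - 1) *
            μHE[finrank ℝ E - 1] (Q '' A)) := by gcongr
      _ = (L : ℝ≥0∞) ^ (finrank ℝ E - 1) *
            (finrank ℝ E * volume (Ioo (0 : ℝ) 1 • (Q '' A))) := by
          rw [hflat]; ring
      _ ≤ (L : ℝ≥0∞) ^ (finrank ℝ E - 1) *
            (finrank ℝ E * ((L : ℝ≥0∞) ^ finrank ℝ E * volume (Ioo (0 : ℝ) 1 • A))) := by gcongr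
      _ = ((L : ℝ≥0∞) ^ finrank ℝ E * (L : ℝ≥0∞) ^ (finrank ℝ E - 1)) *
            (finrank ℝ E * volume (Ioo (0 : ℝ) 1 • A)) := by ring
      _ ≤ _ := by gcongr

end GaussianDual

/-! ### Wulff shapes, their gauge and radial function -/

namespace GaussianDual

open Set Module Metric
open scoped NNReal Pointwise

section Wulff

variable {E : Type*} [NormedAddCommGroup E] [InnerProductSpace ℝ E]

/-- The gauge of the Wulff shape `{x | ∀ v, ⟪x, v⟫ ≤ f v}` of a positive function `f` on the unit
sphere. -/
noncomputable def wulffGauge (f : sphere (0 : E) 1 → ℝ) (x : E) : ℝ :=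
  sSup ((fun v : sphere (0 : E) 1 => ⟪x, (v : E)⟫ / f v) '' univ)

/-- The radial function of the Wulff shape of `f`. -/
noncomputable def wulffRadial (f : sphere (0 : E) 1 → ℝ) (u : sphere (0 : E) 1) : ℝ :=
  (wulffGauge f u)⁻¹

theorem inner_self_sphere (u : sphere (0 : E) 1) : ⟪(u : E), (u : E)⟫ = 1 := by
  simp

variable [FiniteDimensional ℝ E] {f : sphere (0 : E) 1 → ℝ}

theorem exists_div_eq_wulffGauge [Nonempty (sphere (0 : E) 1)] (hf : Continuous f)
    (hpos : ∀ v, 0 < f v) (x : E) : ∃ v : sphere (0 : E) 1, ⟪x, (v : E)⟫ / f v = wulffGauge f x := by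
  have hc : Continuous fun v : sphere (0 : E) 1 => ⟪x, (v : E)⟫ / f v :=
    Continuous.div (by fun_prop) hf fun v => (hpos v).ne'
  obtain ⟨v, -, hv⟩ := isCompact_univ.exists_sSup_image_eq univ_nonempty hc.continuousOn
  exact ⟨v, hv.symm⟩

theorem div_le_wulffGauge (hf : Continuous f) (hpos : ∀ v, 0 < f v) (x : E)
    (v : sphere (0 : E) 1) : ⟪x, (v : E)⟫ / f v ≤ wulffGauge f x := by
  have hc : Continuous fun v : sphere (0 : E) 1 => ⟪x, (v : E)⟫ / f v :=
    Continuous.div (by fun_prop) hf fun v => (hpos v).ne'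
  exact le_csSup (isCompact_univ.bddAbove_image hc.continuousOn) (mem_image_of_mem _ (mem_univ v))

theorem continuous_wulffGauge (hf : Continuous f) (hpos : ∀ v, 0 < f v) :
    Continuous (wulffGauge f) := by
  refine isCompact_univ.continuous_sSup ?_
  refine Continuous.div (by fun_prop) (by fun_prop) fun z => (hpos z.2).ne'

variable [Nonempty (sphere (0 : E) 1)]

theorem wulffGauge_le_iff (hf : Continuous f) (hpos : ∀ v, 0 < f v) {x : E} {r : ℝ} :
    wulffGauge f x ≤ r ↔ ∀ v : sphere (0 : E) 1, ⟪x, (v : E)⟫ ≤ r * f v := by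
  constructor
  · intro h v
    exact (div_le_iff₀ (hpos v)).1 ((div_le_wulffGauge hf hpos x v).trans h)
  · intro h
    obtain ⟨v, hv⟩ := exists_div_eq_wulffGauge hf hpos x
    rw [← hv, div_le_iff₀ (hpos v)]
    exact h v

theorem wulffGauge_smul (hf : Continuous f) (hpos : ∀ v, 0 < f v) {r : ℝ} (hr : 0 ≤ r) (x : E) :
    wulffGauge f (r • x) = r * wulffGauge f x := by
  refine le_antisymm ((wulffGauge_le_iff hf hpos).2 fun v => ?_) ?_
  · have := (wulffGauge_le_iff hf hpos).1 (le_refl (wulffGauge f x)) v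
    rw [real_inner_smul_left, mul_assoc]
    gcongr
  · obtain ⟨v, hv⟩ := exists_div_eq_wulffGauge hf hpos x
    have := div_le_wulffGauge hf hpos (r • x) v
    rwa [real_inner_smul_left, mul_div_assoc, hv] at this

omit [Nonempty (sphere (0 : E) 1)] in
theorem wulffGauge_pos (hf : Continuous f) (hpos : ∀ v, 0 < f v) (u : sphere (0 : E) 1) :
    0 < wulffGauge f u := by
  refine lt_of_lt_of_le ?_ (div_le_wulffGauge hf hpos u u)
  rw [inner_self_sphere]
  exact div_pos one_pos (hpos u)

omit [Nonempty (sphere (0 : E) 1)] in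
theorem wulffRadial_pos (hf : Continuous f) (hpos : ∀ v, 0 < f v) (u : sphere (0 : E) 1) :
    0 < wulffRadial f u :=
  inv_pos.2 (wulffGauge_pos hf hpos u)

omit [Nonempty (sphere (0 : E) 1)] in
theorem continuous_wulffRadial (hf : Continuous f) (hpos : ∀ v, 0 < f v) :
    Continuous (wulffRadial f) :=
  ((continuous_wulffGauge hf hpos).comp continuous_subtype_val).inv₀
    fun u => (wulffGauge_pos hf hpos u).ne'

omit [Nonempty (sphere (0 : E) 1)] in
theorem wulffRadial_le_apply (hf : Continuous f) (hpos : ∀ v, 0 < f v) (u : sphere (0 : E) 1) :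
    wulffRadial f u ≤ f u := by
  have := div_le_wulffGauge hf hpos u u
  rw [inner_self_sphere, one_div] at this
  exact inv_le_of_inv_le₀ (hpos u) this

theorem le_wulffRadial_iff (hf : Continuous f) (hpos : ∀ v, 0 < f v) {u : sphere (0 : E) 1}
    {r : ℝ} (hr : 0 < r) :
    r ≤ wulffRadial f u ↔ ∀ v : sphere (0 : E) 1, ⟪r • (u : E), (v : E)⟫ ≤ f v := by
  rw [wulffRadial, le_inv_comm₀ hr (wulffGauge_pos hf hpos u), wulffGauge_le_iff hf hpos]
  refine forall_congr' fun v => ?_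
  rw [inv_mul_eq_div, le_div_iff₀ hr, real_inner_smul_left, mul_comm]

theorem inner_radial_smul_le (hf : Continuous f) (hpos : ∀ v, 0 < f v) (u v : sphere (0 : E) 1) :
    ⟪wulffRadial f u • (u : E), (v : E)⟫ ≤ f v :=
  (le_wulffRadial_iff hf hpos (wulffRadial_pos hf hpos u)).1 le_rfl v

theorem exists_inner_radial_smul_eq (hf : Continuous f) (hpos : ∀ v, 0 < f v)
    (u : sphere (0 : E) 1) :
    ∃ v : sphere (0 : E) 1, ⟪wulffRadial f u • (u : E), (v : E)⟫ = f v := by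
  obtain ⟨v, hv⟩ := exists_div_eq_wulffGauge hf hpos (u : E)
  refine ⟨v, ?_⟩
  rw [real_inner_smul_left, wulffRadial, inv_mul_eq_iff_eq_mul₀ (wulffGauge_pos hf hpos u).ne', ← hv,
    div_mul_cancel₀ _ (hpos v).ne']

/-- Monotonicity and homogeneity of the Wulff shape in one statement. It gives the exact scaling
rule below and the Lipschitz dependence of the radial function on a perturbation of `f`. -/
theorem wulffRadial_le_mul {f' : sphere (0 : E) 1 → ℝ} (hf : Continuous f) (hpos : ∀ v, 0 < f v)
    (hf' : Continuous f') (hpos' : ∀ v, 0 < f' v) {k : ℝ} (hk : 0 < k)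
    (h : ∀ v, f' v ≤ k * f v) (u : sphere (0 : E) 1) :
    wulffRadial f' u ≤ k * wulffRadial f u := by
  have hρ := wulffRadial_pos hf' hpos' u
  rw [← div_le_iff₀' hk, le_wulffRadial_iff hf hpos (div_pos hρ hk)]
  intro v
  have := (inner_radial_smul_le hf' hpos' u v).trans (h v)
  rw [div_eq_inv_mul, mul_smul, real_inner_smul_left, inv_mul_le_iff₀ hk]
  exact this

theorem wulffRadial_const_mul (hf : Continuous f) (hpos : ∀ v, 0 < f v) {k : ℝ} (hk : 0 < k)
    (u : sphere (0 : E) 1) : wulffRadial (fun v => k * f v) u = k * wulffRadial f u := by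
  have hpos' : ∀ v, 0 < k * f v := fun v => mul_pos hk (hpos v)
  refine le_antisymm (wulffRadial_le_mul hf hpos (by fun_prop) hpos' hk (fun v => le_rfl) u) ?_
  have := wulffRadial_le_mul (f' := f) (f := fun v => k * f v) (by fun_prop) hpos' hf hpos
    (inv_pos.2 hk) (fun v => by field_simp; exact le_rfl) u
  rwa [le_inv_mul_iff₀ hk] at this

/-- The Wulff shape of a positive continuous function on the unit sphere. -/
noncomputable def wulffBody (f : sphere (0 : E) 1 → ℝ) (hf : Continuous f) (hpos : ∀ v, 0 < f v) :
    ConvexBody E where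
  carrier := {x | ∀ v : sphere (0 : E) 1, ⟪x, (v : E)⟫ ≤ f v}
  convex' := by
    simp only [ofPred_forall]
    refine convex_iInter fun v => ?_
    exact convex_halfSpace_le ⟨fun x y => inner_add_left _ _ _, fun c x => by
      simp [real_inner_smul_left]⟩ _
  isCompact' := by
    refine Metric.isCompact_of_isClosed_isBounded ?_ ?_
    · simp only [ofPred_forall]
      exact isClosed_iInter fun v => isClosed_le (by fun_prop) continuous_const
    · obtain ⟨b, hb⟩ := (isCompact_range hf).bddAbove
      refine (isBounded_iff_forall_norm_le).2 ⟨max b 0, fun x hx => ?_⟩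
      by_cases hx0 : x = 0
      · simp [hx0]
      · have hn : 0 < ‖x‖ := norm_pos_iff.2 hx0
        -- Testing in the direction of `x` itself bounds `‖x‖` by a value of `f`.
        have := hx ⟨‖x‖⁻¹ • x, by simp [norm_smul, hn.ne']⟩
        refine (le_trans (le_of_eq ?_) this).trans ((hb (mem_range_self _)).trans (le_max_left _ _))
        simp only [real_inner_smul_right, real_inner_self_eq_norm_sq]
        field_simp
  nonempty' := ⟨0, fun v => by simpa using (hpos v).le⟩

omit [Nonempty (sphere (0 : E) 1)] in
theorem mem_wulffBody (hf : Continuous f) (hpos : ∀ v, 0 < f v) {x : E} :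
    x ∈ wulffBody f hf hpos ↔ ∀ v : sphere (0 : E) 1, ⟪x, (v : E)⟫ ≤ f v := Iff.rfl

theorem exists_pos_le_of_continuous (hf : Continuous f) (hpos : ∀ v, 0 < f v) :
    ∃ a > 0, ∀ v, a ≤ f v := by
  obtain ⟨v, hv⟩ := hf.exists_forall_le_of_hasCompactSupport (HasCompactSupport.of_compactSpace f)
  exact ⟨f v, hpos v, hv⟩

theorem interior_wulffBody_nonempty (hf : Continuous f) (hpos : ∀ v, 0 < f v) :
    (interior (wulffBody f hf hpos : Set E)).Nonempty := by
  obtain ⟨a, ha, haf⟩ := exists_pos_le_of_continuous hf hpos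
  refine ⟨0, mem_interior_iff_mem_nhds.2 (Filter.mem_of_superset (ball_mem_nhds 0 ha) ?_)⟩
  intro x hx v
  rw [mem_ball_zero_iff] at hx
  have := real_inner_le_norm x (v : E)
  rw [norm_eq_of_mem_sphere, mul_one] at this
  linarith [haf v]

end Wulff

end GaussianDual

/-! ### Polar coordinates and the radial mass -/

namespace GaussianDual

open Set Module Metric
open scoped NNReal Pointwise

section Polar

variable {E : Type*} [NormedAddCommGroup E] [InnerProductSpace ℝ E] [FiniteDimensional ℝ E]
  [MeasurableSpace E] [BorelSpace E]

theorem lintegral_eq_lintegral_toSphere [Nontrivial E] {F : E → ℝ≥0∞} (hF : Measurable F) :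
    ∫⁻ x, F x = ∫⁻ u : sphere (0 : E) 1, ∫⁻ r : Ioi (0 : ℝ), F ((r : ℝ) • (u : E))
      ∂(Measure.volumeIoiPow (finrank ℝ E - 1)) ∂(volume : Measure E).toSphere := by
  have h1 : ∫⁻ x, F x = ∫⁻ x : ({0}ᶜ : Set E), F x ∂(volume.comap Subtype.val) := by
    rw [lintegral_subtype_comap (measurableSet_singleton _).compl F, restrict_compl_singleton]
  have h2 := (volume : Measure E).measurePreserving_homeomorphUnitSphereProd.symm
    (homeomorphUnitSphereProd E).toMeasurableEquiv
  rw [h1, ← h2.lintegral_comp (f := fun x : ({0}ᶜ : Set E) => F x) (by fun_prop),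
    lintegral_prod _ (by fun_prop)]
  rfl

theorem lintegral_volumeIoiPow (k : ℕ) {F : ℝ → ℝ≥0∞} :
    ∫⁻ r : Ioi (0 : ℝ), F r ∂(Measure.volumeIoiPow k) =
      ∫⁻ r in Ioi (0 : ℝ), ENNReal.ofReal (r ^ k) * F r := by
  rw [Measure.volumeIoiPow, lintegral_withDensity_eq_lintegral_mul_non_measurable _ (by fun_prop)]
  · exact lintegral_subtype_comap measurableSet_Ioi fun r : ℝ => ENNReal.ofReal (r ^ k) * F r
  · exact ae_of_all _ fun _ => ENNReal.ofReal_lt_top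

/-- The mass `∫₀ʳ s^(q-1) exp(-s²/2) ds` carried by a ray up to radius `r`. -/
noncomputable def radialMass (q r : ℝ) : ℝ := ∫ s in (0 : ℝ)..r, s ^ (q - 1) * Real.exp (-s ^ 2 / 2)

theorem continuous_radialDensity {q : ℝ} (hq : 1 < q) :
    Continuous fun s : ℝ => s ^ (q - 1) * Real.exp (-s ^ 2 / 2) :=
  (Real.continuous_rpow_const (by linarith)).mul (by fun_prop)

theorem hasDerivAt_radialMass {q : ℝ} (hq : 1 < q) (r : ℝ) :
    HasDerivAt (radialMass q) (r ^ (q - 1) * Real.exp (-r ^ 2 / 2)) r :=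
  ((continuous_radialDensity hq).integral_hasStrictDerivAt 0 r).hasDerivAt

theorem continuous_radialMass {q : ℝ} (hq : 1 < q) : Continuous (radialMass q) :=
  continuous_iff_continuousAt.2 fun r => (hasDerivAt_radialMass hq r).continuousAt

theorem radialMass_nonneg (q : ℝ) {r : ℝ} (hr : 0 ≤ r) : 0 ≤ radialMass q r := by
  refine intervalIntegral.integral_nonneg hr fun s hs => ?_
  have := hs.1
  positivity

theorem abs_radialMass_sub_le {q b : ℝ} (hq : 1 < q) {r s : ℝ} (hr : r ∈ Icc 0 b)
    (hs : s ∈ Icc 0 b) : |radialMass q r - radialMass q s| ≤ b ^ (q - 1) * |r - s| := by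
  have hi := fun a b => (continuous_radialDensity hq).intervalIntegrable (μ := volume) a b
  rw [radialMass, radialMass, intervalIntegral.integral_interval_sub_left (hi _ _) (hi _ _)]
  refine intervalIntegral.norm_integral_le_of_norm_le_const
    (f := fun s : ℝ => s ^ (q - 1) * Real.exp (-s ^ 2 / 2)) fun x hx => ?_
  have hx' := uIoc_subset_uIcc hx
  have hxb : x ∈ Icc 0 b := (uIcc_subset_Icc hs hr) hx'
  have h0 : 0 ≤ x ^ (q - 1) := Real.rpow_nonneg hxb.1 _
  rw [Real.norm_eq_abs, abs_of_nonneg (by positivity)]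
  calc x ^ (q - 1) * Real.exp (-x ^ 2 / 2) ≤ x ^ (q - 1) * 1 := by
        gcongr
        rw [Real.exp_le_one_iff]
        nlinarith [sq_nonneg x]
    _ ≤ b ^ (q - 1) := by
        rw [mul_one]
        exact Real.rpow_le_rpow hxb.1 hxb.2 (by linarith)

variable {f : sphere (0 : E) 1 → ℝ}

/-- On the ray through `u` the body is cut out by `r ≤ wulffRadial f u`, and `r ^ (n - 1) * r ^ (q -
n) = r ^ (q - 1)` is integrable at the origin. -/
theorem setLIntegral_wulffBody [Nonempty (sphere (0 : E) 1)] {q : ℝ} (hq : 1 < q)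
    (hf : Continuous f) (hpos : ∀ v, 0 < f v) :
    ∫⁻ x in (wulffBody f hf hpos : Set E),
        ENNReal.ofReal (Real.exp (-‖x‖ ^ 2 / 2) * ‖x‖ ^ (q - finrank ℝ E)) =
      ∫⁻ u, ENNReal.ofReal (radialMass q (wulffRadial f u)) ∂(volume : Measure E).toSphere := by
  obtain ⟨v₀⟩ := ‹Nonempty (sphere (0 : E) 1)›
  have : Nontrivial E := ⟨⟨v₀, 0, ne_of_apply_ne Norm.norm (by simp)⟩⟩
  have : Nonempty (sphere (0 : E) 1) := ⟨v₀⟩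
  have hn : 0 < finrank ℝ E := finrank_pos
  have hK : MeasurableSet (wulffBody f hf hpos : Set E) :=
    (wulffBody f hf hpos).isCompact.measurableSet
  rw [← lintegral_indicator hK, lintegral_eq_lintegral_toSphere
    ((by fun_prop : Measurable fun x : E =>
      ENNReal.ofReal (Real.exp (-‖x‖ ^ 2 / 2) * ‖x‖ ^ (q - finrank ℝ E))).indicator hK)]
  refine lintegral_congr fun u => ?_
  rw [lintegral_volumeIoiPow _ (F := fun r => (wulffBody f hf hpos : Set E).indicator
    (fun x : E => ENNReal.ofReal (Real.exp (-‖x‖ ^ 2 / 2) * ‖x‖ ^ (q - finrank ℝ E))) (r • (u : E)))]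
  have hρ := wulffRadial_pos hf hpos u
  have h1 : ∀ r ∈ Ioi (0 : ℝ), ENNReal.ofReal (r ^ (finrank ℝ E - 1)) *
      (wulffBody f hf hpos : Set E).indicator (fun x : E =>
        ENNReal.ofReal (Real.exp (-‖x‖ ^ 2 / 2) * ‖x‖ ^ (q - finrank ℝ E))) (r • (u : E)) =
      (Ioc 0 (wulffRadial f u)).indicator
        (fun s => ENNReal.ofReal (s ^ (q - 1) * Real.exp (-s ^ 2 / 2))) r := by
    intro r (hr : 0 < r)
    by_cases hru : r ≤ wulffRadial f u
    · have hmem : r • (u : E) ∈ (wulffBody f hf hpos : Set E) :=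
        (le_wulffRadial_iff hf hpos hr).1 hru
      have hnorm : ‖r • (u : E)‖ = r := by
        rw [norm_smul, norm_eq_of_mem_sphere, mul_one, Real.norm_of_nonneg hr.le]
      rw [indicator_of_mem hmem, indicator_of_mem (show r ∈ Ioc 0 (wulffRadial f u) from ⟨hr, hru⟩),
        hnorm, ← ENNReal.ofReal_mul (by positivity)]
      congr 1
      have : r ^ (q - 1) = r ^ (finrank ℝ E - 1) * r ^ (q - finrank ℝ E) := by
        rw [← Real.rpow_natCast, ← Real.rpow_add hr, Nat.cast_pred hn]
        congr 1
        ring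
      rw [this]
      ring
    · have hmem : r • (u : E) ∉ (wulffBody f hf hpos : Set E) := fun h =>
        hru ((le_wulffRadial_iff hf hpos hr).2 h)
      rw [indicator_of_notMem hmem, indicator_of_notMem (fun h => hru h.2), mul_zero]
  rw [setLIntegral_congr_fun measurableSet_Ioi h1, lintegral_indicator measurableSet_Ioc,
    Measure.restrict_restrict measurableSet_Ioc,
    inter_eq_left.2 Ioc_subset_Ioi_self, radialMass,
    intervalIntegral.integral_of_le hρ.le, ofReal_integral_eq_lintegral_ofReal]
  · exact (continuous_radialDensity hq).integrableOn_Ioc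
  · filter_upwards [ae_restrict_mem measurableSet_Ioc] with s hs
    have := hs.1
    positivity

end Polar

end GaussianDual

/-! ### First variation of the radial function and of the mass -/

namespace GaussianDual

open Set Module Metric Filter Topology
open scoped NNReal Pointwise

section Variation

variable {E : Type*} [NormedAddCommGroup E] [InnerProductSpace ℝ E] [FiniteDimensional ℝ E]
  {h g : sphere (0 : E) 1 → ℝ}

theorem exists_perturbation_bounds [Nonempty (sphere (0 : E) 1)] (hh : Continuous h)
    (hpos : ∀ v, 0 < h v) (hg : Continuous g) :
    ∃ a > 0, ∃ b, ∃ M > 0, ∃ t₀ > 0, (∀ v, |g v| ≤ M) ∧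
      ∀ t, |t| < t₀ → ∀ v, a ≤ h v + t * g v ∧ h v + t * g v ≤ b := by
  obtain ⟨a, ha, hah⟩ := exists_pos_le_of_continuous hh hpos
  obtain ⟨b, hb⟩ := (isCompact_range hh).bddAbove
  obtain ⟨M, hM⟩ := (isCompact_range hg.abs).bddAbove
  have hM' : ∀ v, |g v| ≤ max M 1 := fun v => (hM (mem_range_self v)).trans (le_max_left _ _)
  have hM0 : 0 < max M 1 := lt_max_of_lt_right one_pos
  refine ⟨a / 2, by positivity, b + a / 2, max M 1, hM0, a / 2 / max M 1, by positivity, hM',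
    fun t ht v => ?_⟩
  have h1 : |t * g v| ≤ a / 2 := by
    rw [abs_mul]
    rw [lt_div_iff₀ hM0] at ht
    exact (mul_le_mul_of_nonneg_left (hM' v) (abs_nonneg t)).trans ht.le
  have h2 := abs_le.1 h1
  have := hah v
  have : h v ≤ b := hb (mem_range_self v)
  constructor <;> linarith

/-- Aleksandrov's lemma. The value at `t` is the minimum of `(h v + t * g v) / ⟪u, v⟫` over the `v`
with positive denominator, so the envelope principle applies: testing `v₀` bounds it above, and
testing a minimizer for `t` in the unperturbed problem bounds it below. The bounds agree to first
order because the minimizers converge to the unique `v₀`. -/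
theorem hasDerivAt_wulffRadial [Nonempty (sphere (0 : E) 1)] (hh : Continuous h)
    (hpos : ∀ v, 0 < h v) (hg : Continuous g) {u v₀ : sphere (0 : E) 1}
    (huniq : ∀ v : sphere (0 : E) 1, ⟪wulffRadial h u • (u : E), (v : E)⟫ = h v → v = v₀) :
    HasDerivAt (fun t : ℝ => wulffRadial (fun v => h v + t * g v) u)
      (wulffRadial h u * (g v₀ / h v₀)) 0 := by
  obtain ⟨a, ha, b, M, hM, t₀, ht₀, -, hab⟩ := exists_perturbation_bounds hh hpos hg
  have hc : ∀ t : ℝ, Continuous fun v => h v + t * g v := fun t => by fun_prop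
  have hp : ∀ t : ℝ, |t| < t₀ → ∀ v, 0 < h v + t * g v := fun t ht v => ha.trans_le (hab t ht v).1
  have hρ := wulffRadial_pos hh hpos u
  have hv₀ : ⟪wulffRadial h u • (u : E), (v₀ : E)⟫ = h v₀ := by
    obtain ⟨w, hw⟩ := exists_inner_radial_smul_eq hh hpos u
    rwa [← huniq w hw]
  have hnhds : ∀ᶠ t : ℝ in 𝓝 0, |t| < t₀ := by
    filter_upwards [ball_mem_nhds (0 : ℝ) ht₀] with t ht
    simpa using ht
  -- Convergence of the minimizers: the times with a minimizer outside `U` form the projection of a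
  -- closed set along the compact sphere, hence a closed set, and it misses 0. Minimality is
  -- cross-multiplied so that it is visibly closed in `(t, v)`.
  have hev : ∀ U : Set (sphere (0 : E) 1), IsOpen U → v₀ ∈ U → ∀ᶠ t in 𝓝 (0 : ℝ), ∀ v : sphere (0 : E) 1,
      ⟪wulffRadial (fun v => h v + t * g v) u • (u : E), (v : E)⟫ = h v + t * g v → v ∈ U := by
    intro U hU hvU
    have hclosed : IsClosed {z : ℝ × sphere (0 : E) 1 | z.2 ∉ U ∧ ∀ w : sphere (0 : E) 1,
        ⟪(u : E), (w : E)⟫ * (h z.2 + z.1 * g z.2) ≤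
          ⟪(u : E), (z.2 : E)⟫ * (h w + z.1 * g w)} := by
      rw [ofPred_and]
      refine (hU.isClosed_compl.preimage continuous_snd).inter ?_
      rw [ofPred_forall]
      exact isClosed_iInter fun w => isClosed_le (by fun_prop) (by fun_prop)
    have himage := isClosedMap_fst_of_compactSpace _ hclosed
    have h0 : (0 : ℝ) ∉ Prod.fst '' {z : ℝ × sphere (0 : E) 1 | z.2 ∉ U ∧
        ∀ w : sphere (0 : E) 1, ⟪(u : E), (w : E)⟫ * (h z.2 + z.1 * g z.2) ≤
          ⟪(u : E), (z.2 : E)⟫ * (h w + z.1 * g w)} := by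
      rintro ⟨⟨t, v⟩, ⟨hvU', hw⟩, rfl⟩
      simp only [zero_mul, add_zero] at hw hvU'
      refine hvU' ?_
      rw [huniq v ?_]
      · exact hvU
      refine le_antisymm (inner_radial_smul_le hh hpos u v) ?_
      have h1 := hw v₀
      rw [real_inner_smul_left] at hv₀ ⊢
      have h2 : wulffRadial h u * (⟪(u : E), (v₀ : E)⟫ * h v) ≤
          wulffRadial h u * (⟪(u : E), (v : E)⟫ * h v₀) := by gcongr
      rw [← mul_assoc, ← mul_assoc, hv₀, mul_comm] at h2
      exact le_of_mul_le_mul_right h2 (hpos v₀)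
    filter_upwards [himage.isOpen_compl.mem_nhds h0, hnhds] with t ht htt v hv
    by_contra hvU'
    refine ht ⟨(t, v), ⟨hvU', fun w => ?_⟩, rfl⟩
    have hρt := wulffRadial_pos (hc t) (hp t htt) u
    have h1 := inner_radial_smul_le (hc t) (hp t htt) u w
    rw [real_inner_smul_left] at h1 hv
    refine le_of_mul_le_mul_left ?_ hρt
    rw [← mul_assoc, ← mul_assoc, hv, mul_comm (h v + _)]
    exact mul_le_mul_of_nonneg_right h1 (hp t htt v).le
  rw [hasDerivAt_iff_isLittleO, Asymptotics.isLittleO_iff]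
  intro c hc0
  have hφ : Continuous fun v => g v / h v := hg.div hh fun v => (hpos v).ne'
  have hU : IsOpen {v | wulffRadial h u * |g v / h v - g v₀ / h v₀| < c} :=
    isOpen_lt (by fun_prop) continuous_const
  filter_upwards [hev _ hU (by simpa using hc0), hnhds] with t ht htt
  obtain ⟨v, hv⟩ := exists_inner_radial_smul_eq (hc t) (hp t htt) u
  have hvU : wulffRadial h u * |g v / h v - g v₀ / h v₀| < c := ht v hv
  have hρt := wulffRadial_pos (hc t) (hp t htt) u
  have hupper : wulffRadial (fun v => h v + t * g v) u ≤
      wulffRadial h u * (1 + t * (g v₀ / h v₀)) := by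
    have h1 := inner_radial_smul_le (hc t) (hp t htt) u v₀
    rw [real_inner_smul_left] at h1 hv₀
    have h2 : ⟪(u : E), (v₀ : E)⟫ = h v₀ / wulffRadial h u := by rw [← hv₀]; field_simp
    rw [h2, mul_div_assoc', div_le_iff₀ hρ] at h1
    have h3 := hpos v₀
    refine le_of_mul_le_mul_right (h1.trans (le_of_eq ?_)) h3
    field_simp
  have hlower : wulffRadial h u * (1 + t * (g v / h v)) ≤
      wulffRadial (fun v => h v + t * g v) u := by
    have h1 := inner_radial_smul_le hh hpos u v
    rw [real_inner_smul_left] at h1 hv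
    have h2 : ⟪(u : E), (v : E)⟫ = (h v + t * g v) / wulffRadial (fun v => h v + t * g v) u := by
      rw [← hv]; field_simp
    rw [h2, mul_div_assoc', div_le_iff₀ hρt] at h1
    have h3 := hpos v
    refine le_of_mul_le_mul_right (le_trans (le_of_eq ?_) (h1.trans_eq (mul_comm _ _))) h3
    field_simp
  simp only [zero_mul, add_zero, sub_zero, smul_eq_mul]
  rw [Real.norm_eq_abs, Real.norm_eq_abs, abs_sub_comm, abs_of_nonneg (by linarith)]
  calc t * (wulffRadial h u * (g v₀ / h v₀)) -
        (wulffRadial (fun v => h v + t * g v) u - wulffRadial h u)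
      ≤ wulffRadial h u * (-t * (g v / h v - g v₀ / h v₀)) := by linarith
    _ ≤ wulffRadial h u * |-t * (g v / h v - g v₀ / h v₀)| := by gcongr; exact le_abs_self _
    _ = (wulffRadial h u * |g v / h v - g v₀ / h v₀|) * |t| := by rw [abs_mul, abs_neg]; ring
    _ ≤ c * |t| := by gcongr

variable [MeasurableSpace E] [BorelSpace E]

/-- Differentiation under the integral. The pointwise derivative exists only for almost every
direction, while the dominating Lipschitz constant in `t` is uniform over all of them. -/
theorem hasDerivAt_integral_radialMass [Nonempty (sphere (0 : E) 1)] {q : ℝ} (hq : 1 < q)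
    (hh : Continuous h) (hpos : ∀ v, 0 < h v) (hg : Continuous g)
    {σ : Measure (sphere (0 : E) 1)} [IsFiniteMeasure σ]
    {ν : sphere (0 : E) 1 → sphere (0 : E) 1} (hν : AEMeasurable ν σ)
    (huniq : ∀ᵐ u ∂σ, ∀ v : sphere (0 : E) 1,
      ⟪wulffRadial h u • (u : E), (v : E)⟫ = h v → v = ν u) :
    HasDerivAt (fun t : ℝ => ∫ u, radialMass q (wulffRadial (fun v => h v + t * g v) u) ∂σ)
      (∫ u, wulffRadial h u ^ (q - 1) * Real.exp (-wulffRadial h u ^ 2 / 2) *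
        (wulffRadial h u * (g (ν u) / h (ν u))) ∂σ) 0 := by
  obtain ⟨a, ha, b, M, hM, t₀, ht₀, hgM, hab⟩ := exists_perturbation_bounds hh hpos hg
  have hc : ∀ t : ℝ, Continuous fun v => h v + t * g v := fun t => by fun_prop
  have hp : ∀ t : ℝ, |t| < t₀ → ∀ v, 0 < h v + t * g v := fun t ht v => ha.trans_le (hab t ht v).1
  have hb : ∀ t : ℝ, |t| < t₀ → ∀ u, wulffRadial (fun v => h v + t * g v) u ∈ Icc 0 b :=
    fun t ht u => ⟨(wulffRadial_pos (hc t) (hp t ht) u).le,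
      (wulffRadial_le_apply (hc t) (hp t ht) u).trans (hab t ht u).2⟩
  have hb0 : 0 ≤ b := by
    obtain ⟨u⟩ := ‹Nonempty (sphere (0 : E) 1)›
    have := hb 0 (by simpa using ht₀) u
    exact this.1.trans this.2
  have h0 : (fun v => h v + 0 * g v) = h := by simp
  have hcont : ∀ t : ℝ, |t| < t₀ →
      Continuous fun u => radialMass q (wulffRadial (fun v => h v + t * g v) u) := fun t ht =>
    (continuous_radialMass hq).comp (continuous_wulffRadial (hc t) (hp t ht))
  have hρlip : ∀ s t : ℝ, |s| < t₀ → |t| < t₀ → ∀ u,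
      wulffRadial (fun v => h v + s * g v) u - wulffRadial (fun v => h v + t * g v) u ≤
        M / a * b * |s - t| := by
    intro s t hs ht u
    -- Since `a ≤ h + t g` and `|g| ≤ M`, the function at `s` is at most `1 + |s - t| * M / a` times
    -- the function at `t`.
    have h1 := wulffRadial_le_mul (hc t) (hp t ht) (hc s) (hp s hs)
      (k := 1 + |s - t| * M / a) (by positivity) (fun v => by
        have h2 : (s - t) * g v ≤ |s - t| * M := by
          refine (le_abs_self _).trans ?_
          rw [abs_mul]
          gcongr
          exact hgM v
        have h3 : |s - t| * M ≤ |s - t| * M / a * (h v + t * g v) := by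
          rw [div_mul_eq_mul_div, le_div_iff₀ ha]
          gcongr
          exact (hab t ht v).1
        linarith) u
    have h4 : |s - t| * M / a * wulffRadial (fun v => h v + t * g v) u ≤
        |s - t| * M / a * b := by
      gcongr
      exact (hb t ht u).2
    calc _ ≤ |s - t| * M / a * b := by linarith
      _ = _ := by ring
  have hball : ball (0 : ℝ) t₀ ∈ 𝓝 (0 : ℝ) := ball_mem_nhds 0 ht₀
  have hmem : ∀ t ∈ ball (0 : ℝ) t₀, |t| < t₀ := fun t ht => by simpa using ht
  refine (hasDerivAt_integral_of_dominated_loc_of_lip (s := ball (0 : ℝ) t₀)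
    (bound := fun _ => b ^ (q - 1) * (M / a * b)) hball ?_ ?_ ?_ ?_
    (integrable_const _) ?_).2
  · filter_upwards [hball] with t ht
    exact (hcont t (hmem t ht)).aestronglyMeasurable
  · exact (hcont 0 (by simpa using ht₀)).integrable_of_hasCompactSupport
      (HasCompactSupport.of_compactSpace _)
  · have e1 := continuous_wulffRadial hh hpos
    have e2 : AEStronglyMeasurable (fun u => g (ν u) / h (ν u)) σ :=
      ((hg.div hh fun v => (hpos v).ne').measurable.comp_aemeasurable hν).aestronglyMeasurable
    exact ((continuous_radialDensity hq).comp e1).aestronglyMeasurable.mul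
      (e1.aestronglyMeasurable.mul e2)
  · refine ae_of_all _ fun u => LipschitzOnWith.of_dist_le_mul fun s hs t ht => ?_
    rw [Real.dist_eq, Real.dist_eq, Real.coe_nnabs,
      abs_of_nonneg (a := b ^ (q - 1) * (M / a * b)) (by positivity), mul_assoc]
    refine (abs_radialMass_sub_le hq (hb s (hmem s hs) u) (hb t (hmem t ht) u)).trans ?_
    gcongr
    rw [abs_le']
    refine ⟨hρlip s t (hmem s hs) (hmem t ht) u, ?_⟩
    rw [neg_sub, abs_sub_comm]
    exact hρlip t s (hmem t ht) (hmem s hs) u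
  · filter_upwards [huniq] with u hu
    have h1 := hasDerivAt_wulffRadial hh hpos hg hu
    have h2 := hasDerivAt_radialMass hq (wulffRadial (fun v => h v + 0 * g v) u)
    have h3 := HasDerivAt.comp (0 : ℝ) h2 h1
    rw [h0] at h3
    exact h3

end Variation

end GaussianDual

/-! ### Comparing measures locally in the normal direction -/

namespace GaussianDual

open Set Module Metric Filter Topology
open scoped NNReal Pointwise

section Comparison

/-- By compactness finitely many of the balls cover `S`. Cutting `ω` into their preimages gives the
bound with constant `L ^ m` for every `ω`, and then `L` tends to 1. -/
theorem measure_le_of_local_comparison {X S : Type*} [MeasurableSpace X] [MetricSpace S]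
    [CompactSpace S] [MeasurableSpace S] [BorelSpace S] {μ₁ μ₂ : Measure X} {ν : X → S}
    (hν : Measurable ν) (m : ℕ)
    (H : ∀ L : ℝ≥0, 1 < L → ∀ v₀ : S, ∃ δ > 0, ∀ ω : Set X, MeasurableSet ω →
      (∀ u ∈ ω, ν u ∈ ball v₀ δ) → μ₁ ω ≤ (L : ℝ≥0∞) ^ m * μ₂ ω) : μ₁ ≤ μ₂ := by
  refine Measure.le_iff.2 fun ω hω => ?_
  have hL : ∀ L : ℝ≥0, 1 < L → μ₁ ω ≤ (L : ℝ≥0∞) ^ m * μ₂ ω := by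
    intro L hL
    choose δ hδ H' using H L hL
    obtain ⟨t, -, ht⟩ := isCompact_univ.elim_nhds_subcover (fun v : S => ball v (δ v))
      fun v _ => ball_mem_nhds v (hδ v)
    have hfin : ∀ t : Finset S, ∀ ω : Set X, MeasurableSet ω →
        (∀ u ∈ ω, ν u ∈ ⋃ v ∈ t, ball v (δ v)) → μ₁ ω ≤ (L : ℝ≥0∞) ^ m * μ₂ ω := by
      classical
      intro t
      induction t using Finset.induction with
      | empty =>
        intro ω _ h
        have : ω = ∅ := eq_empty_of_forall_notMem fun u hu => by simpa using h u hu
        simp [this]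
      | insert v t _ ih =>
        intro ω hω h
        have hB : MeasurableSet (ν ⁻¹' ball v (δ v)) := hν measurableSet_ball
        rw [← measure_inter_add_sdiff ω hB, ← measure_inter_add_sdiff (μ := μ₂) ω hB, mul_add]
        refine add_le_add (H' v _ (hω.inter hB) fun u hu => hu.2) (ih _ (hω.diff hB) fun u hu => ?_)
        have := h u hu.1
        rw [Finset.set_biUnion_insert] at this
        exact this.resolve_left hu.2
    exact hfin t ω hω fun u _ => ht (mem_univ _)
  have hlim : Tendsto (fun L : ℝ≥0 => (L : ℝ≥0∞) ^ m * μ₂ ω) (𝓝[>] 1) (𝓝 (1 ^ m * μ₂ ω)) := by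
    refine ENNReal.Tendsto.mul_const ?_ (Or.inl (by simp))
    have : Tendsto (fun L : ℝ≥0 => (L : ℝ≥0∞)) (𝓝[>] 1) (𝓝 1) :=
      (ENNReal.continuous_coe.tendsto' 1 1 ENNReal.coe_one).mono_left nhdsWithin_le_nhds
    exact ((ENNReal.continuous_pow m).tendsto 1).comp this
  rw [one_pow, one_mul] at hlim
  exact ge_of_tendsto hlim (by filter_upwards [self_mem_nhdsWithin] with L h using hL L h)

end Comparison

/-! ### Almost every direction has a unique normal -/

section Regular

variable {E : Type*} [NormedAddCommGroup E] [InnerProductSpace ℝ E] [FiniteDimensional ℝ E]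
  {f : sphere (0 : E) 1 → ℝ}

/-- The directions in which the boundary point of the Wulff shape of `f` has at most one normal. -/
def regularDirections (f : sphere (0 : E) 1 → ℝ) : Set (sphere (0 : E) 1) :=
  {u | ∀ v w : sphere (0 : E) 1, ⟪wulffRadial f u • (u : E), (v : E)⟫ = f v →
    ⟪wulffRadial f u • (u : E), (w : E)⟫ = f w → v = w}

theorem lipschitzWith_wulffGauge [Nonempty (sphere (0 : E) 1)] (hf : Continuous f)
    (hpos : ∀ v, 0 < f v) : ∃ C : ℝ≥0, LipschitzWith C (wulffGauge f) := by
  obtain ⟨a, ha, haf⟩ := exists_pos_le_of_continuous hf hpos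
  refine ⟨⟨a⁻¹, by positivity⟩, LipschitzWith.of_le_add_mul _ fun x y => ?_⟩
  obtain ⟨v, hv⟩ := exists_div_eq_wulffGauge hf hpos x
  have h1 := div_le_wulffGauge hf hpos y v
  have h2 : ⟪x, (v : E)⟫ / f v = ⟪y, (v : E)⟫ / f v + ⟪x - y, (v : E)⟫ / f v := by
    rw [← add_div, ← inner_add_left, add_sub_cancel]
  have h3 : ⟪x - y, (v : E)⟫ / f v ≤ a⁻¹ * dist x y := by
    rw [div_le_iff₀ (hpos v), dist_eq_norm]
    have h4 : ⟪x - y, (v : E)⟫ ≤ ‖x - y‖ := by simpa using real_inner_le_norm (x - y) (v : E)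
    have h5 : 1 ≤ a⁻¹ * f v := by
      rw [inv_mul_eq_div, one_le_div ha]; exact haf v
    nlinarith [norm_nonneg (x - y)]
  rw [← hv, h2]
  exact add_le_add h1 h3

/-- For a normal `v` at `u`, the linear function `⟪·, v⟫ / f v` touches the gauge from below at `u`,
so it is the derivative there. Hence `(f v)⁻¹ • v` is determined; its norm gives `f v`, and then
`v`. -/
theorem mem_regularDirections_of_differentiableAt [Nonempty (sphere (0 : E) 1)]
    (hf : Continuous f) (hpos : ∀ v, 0 < f v) {u : sphere (0 : E) 1}
    (hd : DifferentiableAt ℝ (wulffGauge f) u) : u ∈ regularDirections f := by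
  have key : ∀ v : sphere (0 : E) 1, ⟪wulffRadial f u • (u : E), (v : E)⟫ = f v →
      ∀ y, fderiv ℝ (wulffGauge f) u y = ⟪y, (v : E)⟫ / f v := by
    intro v hv y
    have hN := wulffGauge_pos hf hpos u
    have hl : HasFDerivAt (fun y : E => ⟪y, (v : E)⟫ / f v) ((f v)⁻¹ • innerSL ℝ (v : E)) u := by
      have := ((f v)⁻¹ • innerSL ℝ (v : E)).hasFDerivAt (x := (u : E))
      refine this.congr_of_eventuallyEq (Eventually.of_forall fun y => ?_)
      simp [div_eq_inv_mul, real_inner_comm]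
    have hmin : IsLocalMin (wulffGauge f - fun y : E => ⟪y, (v : E)⟫ / f v) u := by
      refine Eventually.of_forall fun y => ?_
      have h1 : ⟪(u : E), (v : E)⟫ / f v = wulffGauge f u := by
        rw [real_inner_smul_left, wulffRadial, inv_mul_eq_iff_eq_mul₀ hN.ne'] at hv
        rw [hv, mul_div_cancel_right₀ _ (hpos v).ne']
      simp only [Pi.sub_apply, h1, sub_self, sub_nonneg]
      exact div_le_wulffGauge hf hpos y v
    have h0 := hmin.hasFDerivAt_eq_zero (hd.hasFDerivAt.sub hl)
    have h1 := congrArg (fun l : E →L[ℝ] ℝ => l y) h0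
    simp only [sub_apply, zero_apply, smul_apply, innerSL_apply_apply,
      smul_eq_mul, sub_eq_zero] at h1
    rw [h1, div_eq_inv_mul, real_inner_comm]
  intro v w hv hw
  have h1 : (f v)⁻¹ • (v : E) = (f w)⁻¹ • (w : E) := by
    refine ext_inner_left ℝ fun y => ?_
    rw [real_inner_smul_right, real_inner_smul_right, ← div_eq_inv_mul, ← div_eq_inv_mul,
      ← key v hv, key w hw]
  have h2 := congrArg norm h1
  rw [norm_smul, norm_smul, norm_eq_of_mem_sphere, norm_eq_of_mem_sphere, mul_one, mul_one,
    Real.norm_of_nonneg (inv_pos.2 (hpos v)).le, Real.norm_of_nonneg (inv_pos.2 (hpos w)).le] at h2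
  rw [h2] at h1
  exact Subtype.ext (smul_right_injective E (inv_pos.2 (hpos w)).ne' h1)

/-- The complement is a countable union, over a lower bound `1 / (k + 1)` for the distance of two
normals, of projections of closed sets along a compact factor. -/
theorem measurableSet_regularDirections [MeasurableSpace E] [BorelSpace E] (hf : Continuous f)
    (hpos : ∀ v, 0 < f v) : MeasurableSet (regularDirections f) := by
  have hρ := continuous_wulffRadial hf hpos
  have hclosed (k : ℕ) : IsClosed {z : sphere (0 : E) 1 × sphere (0 : E) 1 × sphere (0 : E) 1 |
      (⟪wulffRadial f z.1 • (z.1 : E), (z.2.1 : E)⟫ = f z.2.1 ∧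
        ⟪wulffRadial f z.1 • (z.1 : E), (z.2.2 : E)⟫ = f z.2.2) ∧
        1 / ((k : ℝ) + 1) ≤ dist z.2.1 z.2.2} := by
    rw [ofPred_and, ofPred_and]
    exact ((isClosed_eq (by fun_prop) (by fun_prop)).inter
      (isClosed_eq (by fun_prop) (by fun_prop))).inter
      (isClosed_le (by fun_prop) (by fun_prop))
  have heq : (regularDirections f)ᶜ = ⋃ k : ℕ, Prod.fst ''
      {z : sphere (0 : E) 1 × sphere (0 : E) 1 × sphere (0 : E) 1 |
      (⟪wulffRadial f z.1 • (z.1 : E), (z.2.1 : E)⟫ = f z.2.1 ∧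
        ⟪wulffRadial f z.1 • (z.1 : E), (z.2.2 : E)⟫ = f z.2.2) ∧
        1 / ((k : ℝ) + 1) ≤ dist z.2.1 z.2.2} := by
    ext u
    simp only [regularDirections, mem_compl_iff, mem_ofPred_eq, not_forall, mem_iUnion, mem_image]
    constructor
    · rintro ⟨v, w, hv, hw, hvw⟩
      obtain ⟨k, hk⟩ := exists_nat_one_div_lt (dist_pos.2 hvw)
      exact ⟨k, (u, v, w), ⟨⟨hv, hw⟩, hk.le⟩, rfl⟩
    · rintro ⟨k, ⟨u', v, w⟩, ⟨⟨hv, hw⟩, hk⟩, rfl⟩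
      refine ⟨v, w, hv, hw, fun hvw => ?_⟩
      subst hvw
      simp only [dist_self] at hk
      exact absurd hk (not_le.2 (by positivity))
  refine MeasurableSet.of_compl ?_
  rw [heq]
  exact MeasurableSet.iUnion fun k =>
    (isClosedMap_fst_of_compactSpace _ (hclosed k)).measurableSet

/-- Rademacher's theorem for the Lipschitz gauge. A set of directions is null once its cone is null
for volume, and homogeneity makes non-differentiability constant along rays. -/
theorem ae_mem_regularDirections [Nonempty (sphere (0 : E) 1)] [MeasurableSpace E] [BorelSpace E]
    (hf : Continuous f) (hpos : ∀ v, 0 < f v) :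
    ∀ᵐ u ∂(volume : Measure E).toSphere, u ∈ regularDirections f := by
  obtain ⟨C, hC⟩ := lipschitzWith_wulffGauge hf hpos
  have hae : ∀ᵐ x : E, DifferentiableAt ℝ (wulffGauge f) x := hC.ae_differentiableAt
  have hm : MeasurableSet {u : sphere (0 : E) 1 | ¬ DifferentiableAt ℝ (wulffGauge f) u} :=
    ((measurableSet_of_differentiableAt ℝ (wulffGauge f)).preimage measurable_subtype_coe).compl
  have h0 : ∀ᵐ u : sphere (0 : E) 1 ∂(volume : Measure E).toSphere,
      DifferentiableAt ℝ (wulffGauge f) (u : E) := by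
    have hnull : (volume : Measure E) {x | ¬ DifferentiableAt ℝ (wulffGauge f) x} = 0 :=
      ae_iff.1 hae
    rw [ae_iff, Measure.toSphere_apply' _ hm]
    refine mul_eq_zero_of_right _ (measure_mono_null ?_ hnull)
    rintro _ ⟨r, hr, _, ⟨u, hu, rfl⟩, rfl⟩ hd
    refine hu ?_
    have h1 : DifferentiableAt ℝ (fun y : E => r⁻¹ * wulffGauge f (r • y)) u :=
      (DifferentiableAt.comp (u : E) (f := fun y : E => r • y) hd (by fun_prop)).const_mul _
    refine h1.congr_of_eventuallyEq (Eventually.of_forall fun y => ?_)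
    simp only [wulffGauge_smul hf hpos hr.1.le]
    rw [inv_mul_cancel_left₀ hr.1.ne']
  filter_upwards [h0] with u hu using mem_regularDirections_of_differentiableAt hf hpos hu

end Regular

end GaussianDual

/-! ### Volume of a cone over a piece of the boundary -/

namespace GaussianDual

open Set Module Metric Filter Topology
open scoped NNReal Pointwise

section ConeVolume

variable {E : Type*} [NormedAddCommGroup E] [InnerProductSpace ℝ E] [FiniteDimensional ℝ E]
  {f : sphere (0 : E) 1 → ℝ}

omit [FiniteDimensional ℝ E] in
theorem smul_sphere_eq_smul_sphere {r s : ℝ} (hr : 0 < r) (hs : 0 < s) {u w : sphere (0 : E) 1}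
    (h : r • (u : E) = s • (w : E)) : r = s ∧ u = w := by
  have h1 := congrArg norm h
  rw [norm_smul, norm_smul, norm_eq_of_mem_sphere, norm_eq_of_mem_sphere, mul_one, mul_one,
    Real.norm_of_nonneg hr.le, Real.norm_of_nonneg hs.le] at h1
  subst h1
  exact ⟨rfl, Subtype.ext (smul_right_injective E hr.ne' h)⟩

variable [MeasurableSpace E] [BorelSpace E]

theorem measurableSet_image_radial (hf : Continuous f) (hpos : ∀ v, 0 < f v)
    {ω : Set (sphere (0 : E) 1)} (hω : MeasurableSet ω) :
    MeasurableSet ((fun u : sphere (0 : E) 1 => wulffRadial f u • (u : E)) '' ω) := by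
  have hρ := continuous_wulffRadial hf hpos
  refine hω.image_of_continuousOn_injOn (by fun_prop) fun u _ w _ h => ?_
  exact (smul_sphere_eq_smul_sphere (wulffRadial_pos hf hpos u) (wulffRadial_pos hf hpos w) h).2

theorem volume_cone_radial [Nontrivial E] (hf : Continuous f) (hpos : ∀ v, 0 < f v)
    {ω : Set (sphere (0 : E) 1)} (hω : MeasurableSet ω) :
    finrank ℝ E * volume (Ioo (0 : ℝ) 1 •
      ((fun u : sphere (0 : E) 1 => wulffRadial f u • (u : E)) '' ω)) =
    ∫⁻ u in ω, ENNReal.ofReal (wulffRadial f u ^ finrank ℝ E) ∂(volume : Measure E).toSphere := by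
  set A := (fun u : sphere (0 : E) 1 => wulffRadial f u • (u : E)) '' ω
  have hn : 0 < finrank ℝ E := finrank_pos
  have hρ := wulffRadial_pos hf hpos
  have hm : MeasurableSet (Ioo (0 : ℝ) 1 • A) := by
    refine measurableSet_Ioo_smul (measurableSet_image_radial hf hpos hω) ?_
    rintro _ ⟨u, -, rfl⟩ _ ⟨w, -, rfl⟩ r hr h
    rw [smul_smul] at h
    obtain ⟨h1, rfl⟩ := smul_sphere_eq_smul_sphere (mul_pos hr (hρ u)) (hρ w) h
    exact mul_right_cancel₀ (hρ u).ne' (by rw [h1, one_mul])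
  have hmem : ∀ u : sphere (0 : E) 1, ∀ r : Ioi (0 : ℝ), (r : ℝ) • (u : E) ∈ Ioo (0 : ℝ) 1 • A ↔
      u ∈ ω ∧ r < ⟨wulffRadial f u, hρ u⟩ := by
    intro u r
    constructor
    · rintro ⟨s, hs, _, ⟨w, hw, rfl⟩, h⟩
      simp only [smul_smul] at h
      obtain ⟨h1, rfl⟩ := smul_sphere_eq_smul_sphere (mul_pos hs.1 (hρ w)) r.2 h
      refine ⟨hw, ?_⟩
      rw [← Subtype.coe_lt_coe, ← h1]
      exact mul_lt_of_lt_one_left (hρ w) hs.2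
    · rintro ⟨hu, hr⟩
      have hr' : (r : ℝ) < wulffRadial f u := hr
      refine ⟨r / wulffRadial f u, ⟨div_pos r.2 (hρ u), (div_lt_one (hρ u)).2 hr'⟩, _,
        ⟨u, hu, rfl⟩, ?_⟩
      simp only [smul_smul, div_mul_cancel₀ _ (hρ u).ne']
  have hin : ∀ u : sphere (0 : E) 1, ∫⁻ r : Ioi (0 : ℝ),
      (Ioo (0 : ℝ) 1 • A).indicator (fun _ => (1 : ℝ≥0∞)) ((r : ℝ) • (u : E))
        ∂(Measure.volumeIoiPow (finrank ℝ E - 1)) =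
      ω.indicator (fun u => ENNReal.ofReal (wulffRadial f u ^ finrank ℝ E / finrank ℝ E)) u := by
    intro u
    by_cases hu : u ∈ ω
    · have : ∀ r : Ioi (0 : ℝ),
          (Ioo (0 : ℝ) 1 • A).indicator (fun _ => (1 : ℝ≥0∞)) ((r : ℝ) • (u : E)) =
          (Iio (⟨wulffRadial f u, hρ u⟩ : Ioi (0 : ℝ))).indicator (fun _ => 1) r := by
        intro r
        by_cases hr : r < ⟨wulffRadial f u, hρ u⟩
        · rw [indicator_of_mem ((hmem u r).2 ⟨hu, hr⟩), indicator_of_mem (by exact hr)]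
        · rw [indicator_of_notMem fun h => hr ((hmem u r).1 h).2,
            indicator_of_notMem (by exact hr)]
      simp only [this]
      rw [lintegral_indicator_const measurableSet_Iio, one_mul, indicator_of_mem hu,
        Measure.volumeIoiPow_apply_Iio, Nat.sub_add_cancel hn, Nat.cast_pred hn, sub_add_cancel]
    · have : ∀ r : Ioi (0 : ℝ),
          (Ioo (0 : ℝ) 1 • A).indicator (fun _ => (1 : ℝ≥0∞)) ((r : ℝ) • (u : E)) = 0 :=
        fun r => indicator_of_notMem (fun h => hu ((hmem u r).1 h).1) _
      simp only [this, lintegral_zero, indicator_of_notMem hu]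
  rw [← lintegral_indicator_one hm, lintegral_eq_lintegral_toSphere
    (measurable_one.indicator hm)]
  change _ * ∫⁻ u : sphere (0 : E) 1, ∫⁻ r : Ioi (0 : ℝ),
      (Ioo (0 : ℝ) 1 • A).indicator (fun _ => (1 : ℝ≥0∞)) ((r : ℝ) • (u : E))
        ∂(Measure.volumeIoiPow (finrank ℝ E - 1)) ∂_ = _
  simp only [hin]
  have hmeas := (continuous_wulffRadial hf hpos).measurable
  rw [lintegral_indicator hω, ← lintegral_const_mul _ (by fun_prop)]
  refine lintegral_congr fun u => ?_
  rw [← ENNReal.ofReal_natCast, ← ENNReal.ofReal_mul (by positivity)]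
  congr 1
  field_simp

end ConeVolume

/-! ### Symmetric bodies as Wulff shapes of their support functions -/

section Body

variable {n : ℕ} {K : ConvexBody (EuclideanSpace ℝ (Fin n))}

/-- The restriction of the support function to the unit sphere. -/
noncomputable def sphereSupport (K : ConvexBody (EuclideanSpace ℝ (Fin n)))
    (v : sphere (0 : EuclideanSpace ℝ (Fin n)) 1) : ℝ := supportFunction K v

theorem continuous_sphereSupport (K : ConvexBody (EuclideanSpace ℝ (Fin n))) :
    Continuous (sphereSupport K) :=
  (continuous_supportFunction K).comp continuous_subtype_val

theorem inner_le_sphereSupport {x : EuclideanSpace ℝ (Fin n)} (hx : x ∈ K)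
    (v : sphere (0 : EuclideanSpace ℝ (Fin n)) 1) :
    ⟪x, (v : EuclideanSpace ℝ (Fin n))⟫ ≤ sphereSupport K v := by
  rw [real_inner_comm]
  refine le_csSup (K.isCompact.bddAbove_image (by fun_prop)) ⟨x, hx, rfl⟩

theorem sphereSupport_le {v : sphere (0 : EuclideanSpace ℝ (Fin n)) 1} {r : ℝ}
    (h : ∀ x ∈ K, ⟪x, (v : EuclideanSpace ℝ (Fin n))⟫ ≤ r) : sphereSupport K v ≤ r := by
  refine csSup_le (K.nonempty.image _) ?_
  rintro _ ⟨x, hx, rfl⟩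
  simp only [real_inner_comm x]
  exact h x hx

theorem zero_mem_interior (hK : K ∈ symmetricBodies n) :
    (0 : EuclideanSpace ℝ (Fin n)) ∈ interior (K : Set (EuclideanSpace ℝ (Fin n))) := by
  obtain ⟨⟨x, hx⟩, hsymm⟩ := hK
  have hx' : -x ∈ interior (K : Set (EuclideanSpace ℝ (Fin n))) := by
    have hsub : -interior (K : Set (EuclideanSpace ℝ (Fin n))) ⊆ K := fun y hy => by
      have := hsymm _ (interior_subset hy)
      rwa [neg_neg] at this
    exact interior_maximal hsub isOpen_interior.neg (by simpa using hx)
  have := K.convex.interior hx hx' (a := 1 / 2) (b := 1 / 2) (by norm_num) (by norm_num)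
    (by norm_num)
  simpa using this

theorem sphereSupport_pos (hK : K ∈ symmetricBodies n)
    (v : sphere (0 : EuclideanSpace ℝ (Fin n)) 1) : 0 < sphereSupport K v := by
  obtain ⟨ε, hε, hb⟩ := Metric.mem_nhds_iff.1 (mem_interior_iff_mem_nhds.1 (zero_mem_interior hK))
  have hmem : (ε / 2) • (v : EuclideanSpace ℝ (Fin n)) ∈ K := hb (by
    rw [mem_ball_zero_iff, norm_smul, norm_eq_of_mem_sphere, mul_one,
      Real.norm_of_nonneg (by positivity)]
    linarith)
  refine lt_of_lt_of_le ?_ (inner_le_sphereSupport hmem v)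
  rw [real_inner_smul_left, inner_self_sphere]
  positivity

theorem sphereSupport_neg (hK : K ∈ symmetricBodies n)
    (v : sphere (0 : EuclideanSpace ℝ (Fin n)) 1) : sphereSupport K (-v) = sphereSupport K v := by
  have key : ∀ v : sphere (0 : EuclideanSpace ℝ (Fin n)) 1,
      sphereSupport K (-v) ≤ sphereSupport K v := fun v => sphereSupport_le fun x hx => by
    have := inner_le_sphereSupport (hK.2 x hx) v
    simpa using this
  exact le_antisymm (key v) (by simpa using key (-v))

/-- A point outside `K` is strictly separated from it by Hahn–Banach; the normalized separating
vector violates its inequality. -/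
theorem mem_iff_forall_inner_le (hK : K ∈ symmetricBodies n) {x : EuclideanSpace ℝ (Fin n)} :
    x ∈ K ↔ ∀ v : sphere (0 : EuclideanSpace ℝ (Fin n)) 1,
      ⟪x, (v : EuclideanSpace ℝ (Fin n))⟫ ≤ sphereSupport K v := by
  refine ⟨fun hx v => inner_le_sphereSupport hx v, fun h => ?_⟩
  by_contra hx
  obtain ⟨l, r, hl, hr⟩ := geometric_hahn_banach_closed_point K.convex K.isCompact.isClosed hx
  set w := (InnerProductSpace.toDual ℝ (EuclideanSpace ℝ (Fin n))).symm l with hw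
  have hlw : ∀ y, l y = ⟪y, w⟫ := fun y => by
    rw [real_inner_comm, hw, InnerProductSpace.toDual_symm_apply]
  have h0 := hl 0 (interior_subset (zero_mem_interior hK))
  rw [map_zero] at h0
  have hwn : 0 < ‖w‖ := by
    rw [norm_pos_iff]
    intro hw0
    have := hlw x
    rw [hw0, inner_zero_right] at this
    linarith
  have h1 := h ⟨‖w‖⁻¹ • w, by simp [norm_smul, hwn.ne']⟩
  have h2 : sphereSupport K ⟨‖w‖⁻¹ • w, by simp [norm_smul, hwn.ne']⟩ ≤ ‖w‖⁻¹ * r := by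
    refine sphereSupport_le fun y hy => ?_
    simp only [real_inner_smul_right, ← hlw]
    gcongr
    exact (hl y hy).le
  simp only [real_inner_smul_right, ← hlw] at h1
  have h3 := h1.trans h2
  rw [mul_le_mul_iff_right₀ (inv_pos.2 hwn)] at h3
  linarith

theorem wulffBody_sphereSupport (hK : K ∈ symmetricBodies n) :
    wulffBody (sphereSupport K) (continuous_sphereSupport K) (sphereSupport_pos hK) = K :=
  ConvexBody.ext (Set.ext fun _ => (mem_iff_forall_inner_le hK).symm)

end Body

end GaussianDual

/-! ### From the regular boundary to the sphere of directions -/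

namespace GaussianDual

open Set Module Metric Filter Topology
open scoped NNReal Pointwise

section RegularBoundary

variable {n : ℕ} {K : ConvexBody (EuclideanSpace ℝ (Fin n))}

/-- The boundary point of `K` in the direction `u`. -/
noncomputable def boundaryPoint (K : ConvexBody (EuclideanSpace ℝ (Fin n)))
    (u : sphere (0 : EuclideanSpace ℝ (Fin n)) 1) : EuclideanSpace ℝ (Fin n) :=
  wulffRadial (sphereSupport K) u • (u : EuclideanSpace ℝ (Fin n))

theorem continuous_boundaryPoint (hK : K ∈ symmetricBodies n) : Continuous (boundaryPoint K) :=
  (continuous_wulffRadial (continuous_sphereSupport K) (sphereSupport_pos hK)).smul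
    continuous_subtype_val

theorem norm_boundaryPoint (hK : K ∈ symmetricBodies n)
    (u : sphere (0 : EuclideanSpace ℝ (Fin n)) 1) :
    ‖boundaryPoint K u‖ = wulffRadial (sphereSupport K) u := by
  rw [boundaryPoint, norm_smul, norm_eq_of_mem_sphere, mul_one, Real.norm_of_nonneg
    (wulffRadial_pos (continuous_sphereSupport K) (sphereSupport_pos hK) u).le]

theorem boundaryPoint_mem_frontier (hK : K ∈ symmetricBodies n)
    (u : sphere (0 : EuclideanSpace ℝ (Fin n)) 1) :
    boundaryPoint K u ∈ frontier (K : Set (EuclideanSpace ℝ (Fin n))) := by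
  have : Nonempty (sphere (0 : EuclideanSpace ℝ (Fin n)) 1) := ⟨u⟩
  have hc := continuous_sphereSupport K
  have hp := sphereSupport_pos hK
  have hmem : boundaryPoint K u ∈ K :=
    (mem_iff_forall_inner_le hK).2 fun v => inner_radial_smul_le hc hp u v
  refine ⟨subset_closure hmem, fun hint => ?_⟩
  obtain ⟨v, hv⟩ := exists_inner_radial_smul_eq hc hp u
  have hcont : Tendsto (fun r : ℝ => r • boundaryPoint K u) (𝓝[>] 1) (𝓝 (boundaryPoint K u)) := by
    refine (Continuous.tendsto' (by fun_prop) _ _ ?_).mono_left nhdsWithin_le_nhds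
    rw [one_smul]
  obtain ⟨r, hr, hr1⟩ := ((hcont.eventually (mem_interior_iff_mem_nhds.1 hint)).and
    self_mem_nhdsWithin).exists
  have h1 := inner_le_sphereSupport hr v
  rw [real_inner_smul_left, boundaryPoint, hv] at h1
  have := hp v
  have hr1' : (1 : ℝ) < r := hr1
  nlinarith

theorem boundaryPoint_mem_regularBoundary (hK : K ∈ symmetricBodies n)
    {u : sphere (0 : EuclideanSpace ℝ (Fin n)) 1} (hu : u ∈ regularDirections (sphereSupport K)) :
    boundaryPoint K u ∈ regularBoundary K := by
  have : Nonempty (sphere (0 : EuclideanSpace ℝ (Fin n)) 1) := ⟨u⟩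
  refine ⟨boundaryPoint_mem_frontier hK u, ?_⟩
  obtain ⟨v, hv⟩ := exists_inner_radial_smul_eq (continuous_sphereSupport K) (sphereSupport_pos hK) u
  exact ⟨v, hv, fun w hw => hu w v hw hv⟩

theorem inner_gaussMap (x : regularBoundary K) :
    ⟪(x : EuclideanSpace ℝ (Fin n)), (gaussMap K x : EuclideanSpace ℝ (Fin n))⟫ =
      sphereSupport K (gaussMap K x) :=
  x.2.2.choose_spec.1

theorem eq_gaussMap {x : regularBoundary K} {v : sphere (0 : EuclideanSpace ℝ (Fin n)) 1}
    (hv : ⟪(x : EuclideanSpace ℝ (Fin n)), (v : EuclideanSpace ℝ (Fin n))⟫ = sphereSupport K v) :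
    v = gaussMap K x :=
  x.2.2.choose_spec.2 v hv

theorem regularBoundary_subset : regularBoundary K ⊆ K := fun _ hx =>
  K.isCompact.isClosed.frontier_subset hx.1

theorem norm_regularBoundary_pos (hK : K ∈ symmetricBodies n) (x : regularBoundary K) :
    0 < ‖(x : EuclideanSpace ℝ (Fin n))‖ := by
  rw [norm_pos_iff]
  intro h
  have h1 := inner_gaussMap x
  rw [h, inner_zero_left] at h1
  exact (sphereSupport_pos hK _).ne h1

/-- The direction of a boundary point. -/
noncomputable def boundaryDirection (hK : K ∈ symmetricBodies n) (x : regularBoundary K) :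
    sphere (0 : EuclideanSpace ℝ (Fin n)) 1 :=
  ⟨‖(x : EuclideanSpace ℝ (Fin n))‖⁻¹ • (x : EuclideanSpace ℝ (Fin n)), by
    simp [norm_smul, (norm_regularBoundary_pos hK x).ne']⟩

theorem continuous_boundaryDirection (hK : K ∈ symmetricBodies n) :
    Continuous (boundaryDirection hK) := by
  have hn : Continuous fun x : regularBoundary K => ‖(x : EuclideanSpace ℝ (Fin n))‖ := by fun_prop
  have h : Continuous fun x : regularBoundary K =>
      ‖(x : EuclideanSpace ℝ (Fin n))‖⁻¹ • (x : EuclideanSpace ℝ (Fin n)) :=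
    (hn.inv₀ fun x => (norm_regularBoundary_pos hK x).ne').smul continuous_subtype_val
  exact h.subtype_mk _

/-- The radial function is at least `‖x‖` because `x` lies in `K`, and at most `‖x‖` because the
supporting hyperplane at `x` cuts the ray transversally. -/
theorem boundaryPoint_boundaryDirection (hK : K ∈ symmetricBodies n) (x : regularBoundary K) :
    boundaryPoint K (boundaryDirection hK x) = x := by
  have : Nonempty (sphere (0 : EuclideanSpace ℝ (Fin n)) 1) := ⟨boundaryDirection hK x⟩
  have hc := continuous_sphereSupport K
  have hp := sphereSupport_pos hK
  have hx := norm_regularBoundary_pos hK x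
  have hxu : ‖(x : EuclideanSpace ℝ (Fin n))‖ •
      (boundaryDirection hK x : EuclideanSpace ℝ (Fin n)) = x := by
    simp only [boundaryDirection, smul_smul, mul_inv_cancel₀ hx.ne', one_smul]
  have hv := inner_gaussMap x
  have h1 : ‖(x : EuclideanSpace ℝ (Fin n))‖ ≤
      wulffRadial (sphereSupport K) (boundaryDirection hK x) := by
    rw [le_wulffRadial_iff hc hp hx, hxu]
    exact (mem_iff_forall_inner_le hK).1 (regularBoundary_subset x.2)
  have h2 : wulffRadial (sphereSupport K) (boundaryDirection hK x) ≤
      ‖(x : EuclideanSpace ℝ (Fin n))‖ := by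
    have h3 := inner_radial_smul_le hc hp (boundaryDirection hK x) (gaussMap K x)
    have h5 : ⟪(x : EuclideanSpace ℝ (Fin n)), (gaussMap K x : EuclideanSpace ℝ (Fin n))⟫ =
        ‖(x : EuclideanSpace ℝ (Fin n))‖ * ⟪(boundaryDirection hK x : EuclideanSpace ℝ (Fin n)),
          (gaussMap K x : EuclideanSpace ℝ (Fin n))⟫ := by
      rw [← real_inner_smul_left, hxu]
    rw [← hv, h5, real_inner_smul_left] at h3
    refine le_of_mul_le_mul_right h3 ?_
    have h4 := hp (gaussMap K x)
    rw [← hv, h5] at h4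
    exact pos_of_mul_pos_right h4 hx.le
  rw [boundaryPoint, h2.antisymm h1, hxu]

theorem boundaryDirection_mem_regularDirections (hK : K ∈ symmetricBodies n)
    (x : regularBoundary K) : boundaryDirection hK x ∈ regularDirections (sphereSupport K) := by
  intro v w hv hw
  have hb := boundaryPoint_boundaryDirection hK x
  rw [boundaryPoint] at hb
  rw [hb] at hv hw
  exact (eq_gaussMap hv).trans (eq_gaussMap hw).symm

theorem boundaryDirection_boundaryPoint (hK : K ∈ symmetricBodies n)
    {u : sphere (0 : EuclideanSpace ℝ (Fin n)) 1} (hu : boundaryPoint K u ∈ regularBoundary K) :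
    boundaryDirection hK ⟨boundaryPoint K u, hu⟩ = u := by
  have hρ := wulffRadial_pos (continuous_sphereSupport K) (sphereSupport_pos hK)
  exact (smul_sphere_eq_smul_sphere (hρ _) (hρ _)
    (boundaryPoint_boundaryDirection hK ⟨boundaryPoint K u, hu⟩)).2

open Classical in
/-- The normal of `K` at the boundary point in the direction `u`; it is `u` itself if that boundary
point is not regular. -/
noncomputable def radialGaussMap (K : ConvexBody (EuclideanSpace ℝ (Fin n)))
    (u : sphere (0 : EuclideanSpace ℝ (Fin n)) 1) : sphere (0 : EuclideanSpace ℝ (Fin n)) 1 :=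
  if hu : boundaryPoint K u ∈ regularBoundary K then gaussMap K ⟨boundaryPoint K u, hu⟩ else u

theorem radialGaussMap_boundaryDirection (hK : K ∈ symmetricBodies n) (x : regularBoundary K) :
    radialGaussMap K (boundaryDirection hK x) = gaussMap K x := by
  have hb := boundaryPoint_boundaryDirection hK x
  have hmem : boundaryPoint K (boundaryDirection hK x) ∈ regularBoundary K := hb ▸ x.2
  rw [radialGaussMap, dif_pos hmem]
  congr 1
  exact Subtype.ext hb

theorem eq_radialGaussMap (hK : K ∈ symmetricBodies n)
    {u : sphere (0 : EuclideanSpace ℝ (Fin n)) 1} (hu : u ∈ regularDirections (sphereSupport K))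
    {v : sphere (0 : EuclideanSpace ℝ (Fin n)) 1}
    (hv : ⟪wulffRadial (sphereSupport K) u • (u : EuclideanSpace ℝ (Fin n)),
      (v : EuclideanSpace ℝ (Fin n))⟫ = sphereSupport K v) : v = radialGaussMap K u := by
  rw [radialGaussMap, dif_pos (boundaryPoint_mem_regularBoundary hK hu)]
  exact eq_gaussMap hv

/-- The map is continuous on the measurable set of regular directions and is the identity off it,
thanks to the chosen default value. -/
theorem measurable_radialGaussMap (hK : K ∈ symmetricBodies n) :
    Measurable (radialGaussMap K) := by
  classical
  have hm := measurableSet_regularDirections (continuous_sphereSupport K) (sphereSupport_pos hK)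
  have hcont : ContinuousOn (radialGaussMap K) (regularDirections (sphereSupport K)) := by
    rw [continuousOn_iff_continuous_domRestrict]
    have h1 : Continuous fun u : regularDirections (sphereSupport K) =>
        (⟨boundaryPoint K u, boundaryPoint_mem_regularBoundary hK u.2⟩ : regularBoundary K) :=
      Continuous.subtype_mk ((continuous_boundaryPoint hK).comp continuous_subtype_val) _
    refine ((continuous_gaussMap K).comp h1).congr fun u => ?_
    simp only [domRestrict_apply, radialGaussMap,
      dif_pos (boundaryPoint_mem_regularBoundary hK u.2), Function.comp_apply]
  have h2 := hcont.measurable_piecewise (g := id) continuousOn_id hm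
  refine (funext fun u => ?_ : (regularDirections (sphereSupport K)).piecewise
    (radialGaussMap K) id = radialGaussMap K) ▸ h2
  by_cases hu : u ∈ regularDirections (sphereSupport K)
  · rw [piecewise_eq_of_mem _ _ _ hu]
  · rw [piecewise_eq_of_notMem _ _ _ hu, radialGaussMap, dif_neg, id]
    intro hb
    exact hu (boundaryDirection_boundaryPoint hK hb ▸
      boundaryDirection_mem_regularDirections hK ⟨_, hb⟩)

theorem image_boundaryDirection_preimage (hK : K ∈ symmetricBodies n)
    (ω : Set (sphere (0 : EuclideanSpace ℝ (Fin n)) 1)) :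
    ((↑) : regularBoundary K → EuclideanSpace ℝ (Fin n)) '' (boundaryDirection hK ⁻¹' ω) =
      boundaryPoint K '' (ω ∩ regularDirections (sphereSupport K)) := by
  ext y
  constructor
  · rintro ⟨x, hx, rfl⟩
    exact ⟨boundaryDirection hK x, ⟨hx, boundaryDirection_mem_regularDirections hK x⟩,
      boundaryPoint_boundaryDirection hK x⟩
  · rintro ⟨u, ⟨hu, hur⟩, rfl⟩
    refine ⟨⟨boundaryPoint K u, boundaryPoint_mem_regularBoundary hK hur⟩, ?_, rfl⟩
    rw [mem_preimage, boundaryDirection_boundaryPoint]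
    exact hu

/-- The surface measure of `∂'K` with density the support function at the normal. -/
noncomputable def supportSurfaceMeasure (K : ConvexBody (EuclideanSpace ℝ (Fin n))) :
    Measure (regularBoundary K) :=
  (Measure.euclideanHausdorffMeasure (n - 1) : Measure (regularBoundary K)).withDensity
    fun x => ENNReal.ofReal (sphereSupport K (gaussMap K x))

/-- Both measures give `n` times the volume of the cone over a boundary patch. On patches whose
normals lie near a fixed `v₀` they are compared by `exists_cone_comparison` up to a factor `L ^ (2 *
n + 1)`: `2 * n` powers come from the cones and one from replacing `h (ν)` by `h v₀`. -/
theorem map_boundaryDirection_supportSurfaceMeasure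
    [Nonempty (sphere (0 : EuclideanSpace ℝ (Fin n)) 1)] (hK : K ∈ symmetricBodies n) :
    (supportSurfaceMeasure K).map (boundaryDirection hK) =
      (volume : Measure (EuclideanSpace ℝ (Fin n))).toSphere.withDensity
        fun u => ENNReal.ofReal (wulffRadial (sphereSupport K) u ^ n) := by
  obtain ⟨u₀⟩ := ‹Nonempty (sphere (0 : EuclideanSpace ℝ (Fin n)) 1)›
  have : Nonempty (sphere (0 : EuclideanSpace ℝ (Fin n)) 1) := ⟨u₀⟩
  have : Nontrivial (EuclideanSpace ℝ (Fin n)) := ⟨⟨u₀, 0, ne_of_apply_ne Norm.norm (by simp)⟩⟩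
  set h := sphereSupport K with hh
  have hc : Continuous h := continuous_sphereSupport K
  have hp : ∀ v, 0 < h v := sphereSupport_pos hK
  obtain ⟨R, hR⟩ := (isCompact_range hc).bddAbove
  have hR0 : 0 ≤ R := (hp u₀).le.trans (hR (mem_range_self u₀))
  have hRb : ∀ x : regularBoundary K, ‖(x : EuclideanSpace ℝ (Fin n))‖ ≤ R := fun x => by
    rw [← boundaryPoint_boundaryDirection hK x, norm_boundaryPoint hK]
    exact (wulffRadial_le_apply hc hp _).trans (hR (mem_range_self _))
  have hdim : finrank ℝ (EuclideanSpace ℝ (Fin n)) = n := finrank_euclideanSpace_fin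
  have hdm := (continuous_boundaryDirection hK).measurable
  have hgm := (continuous_gaussMap K).measurable
  have hRm := measurableSet_regularDirections hc hp
  have key : ∀ L : ℝ≥0, 1 < L → ∀ v₀ : sphere (0 : EuclideanSpace ℝ (Fin n)) 1,
      ∃ δ > 0, ∀ ω, MeasurableSet ω → (∀ u ∈ ω, radialGaussMap K u ∈ ball v₀ δ) →
      (supportSurfaceMeasure K).map (boundaryDirection hK) ω ≤ (L : ℝ≥0∞) ^ (2 * n + 1) *
        (volume : Measure (EuclideanSpace ℝ (Fin n))).toSphere.withDensity
          (fun u => ENNReal.ofReal (wulffRadial h u ^ n)) ω ∧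
      (volume : Measure (EuclideanSpace ℝ (Fin n))).toSphere.withDensity
          (fun u => ENNReal.ofReal (wulffRadial h u ^ n)) ω ≤ (L : ℝ≥0∞) ^ (2 * n + 1) *
        (supportSurfaceMeasure K).map (boundaryDirection hK) ω := by
    intro L hL v₀
    have hL0 : (0 : ℝ) < L := by exact_mod_cast zero_lt_one.trans hL
    have hL1 : (1 : ℝ) < L := by exact_mod_cast hL
    obtain ⟨δ', hδ', H⟩ := exists_cone_comparison (E := EuclideanSpace ℝ (Fin n))
      (v := (v₀ : EuclideanSpace ℝ (Fin n))) (norm_eq_of_mem_sphere v₀) (hp v₀) hR0 hL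
    rw [hdim] at H
    -- The two halves of `δ'` together put the patch within `δ'` of the supporting hyperplane of
    -- `v₀`. The bound on `dist v v₀` controls the tilt, and the last two conditions compare the
    -- densities.
    have hev : ∀ᶠ v in 𝓝 v₀, (dist v v₀ * R < δ' / 2 ∧ dist v v₀ < δ') ∧
        (|h v - h v₀| < δ' / 2 ∧ h v < L * h v₀ ∧ h v₀ < L * h v) := by
      refine ((IsOpen.and ?_ ?_).and (IsOpen.and ?_ (IsOpen.and ?_ ?_))).mem_nhds ?_
      · exact isOpen_lt (by fun_prop) continuous_const
      · exact isOpen_lt (by fun_prop) continuous_const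
      · exact isOpen_lt (by fun_prop) continuous_const
      · exact isOpen_lt (by fun_prop) continuous_const
      · exact isOpen_lt (by fun_prop) (by fun_prop)
      · have := lt_mul_of_one_lt_left (hp v₀) hL1
        simp [hδ', this]
    obtain ⟨δ, hδ, hball⟩ := Metric.eventually_nhds_iff_ball.1 hev
    refine ⟨δ, hδ, fun ω hω hωδ => ?_⟩
    set A := ((↑) : regularBoundary K → EuclideanSpace ℝ (Fin n)) '' (boundaryDirection hK ⁻¹' ω)
      with hA
    have hAeq := image_boundaryDirection_preimage hK ω
    have hν : ∀ x ∈ boundaryDirection hK ⁻¹' ω, gaussMap K x ∈ ball v₀ δ := fun x hx => by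
      rw [← radialGaussMap_boundaryDirection hK x]
      exact hωδ _ hx
    have hnv : ∀ v : sphere (0 : EuclideanSpace ℝ (Fin n)) 1, ∀ y : EuclideanSpace ℝ (Fin n),
        |⟪y, (v : EuclideanSpace ℝ (Fin n)) - v₀⟫| ≤ ‖y‖ * dist v v₀ := fun v y => by
      rw [Subtype.dist_eq, dist_eq_norm]
      exact abs_real_inner_le_norm _ _
    have hAm : MeasurableSet A := by
      rw [hA, hAeq]
      exact measurableSet_image_radial hc hp (hω.inter hRm)
    obtain ⟨H1, H2⟩ := H A hAm (by rintro _ ⟨x, -, rfl⟩; exact hRb x) (by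
      rintro _ ⟨x, hx, rfl⟩
      obtain ⟨⟨q1, -⟩, q2, -⟩ := hball _ (hν x hx)
      have h1 := inner_le_sphereSupport (regularBoundary_subset x.2) v₀
      have h2 := inner_gaussMap x
      have h3 := hnv (gaussMap K x) x
      rw [inner_sub_right, h2] at h3
      have h4 : ‖(x : EuclideanSpace ℝ (Fin n))‖ * dist (gaussMap K x) v₀ ≤
          dist (gaussMap K x) v₀ * R := by
        rw [mul_comm]; gcongr; exact hRb x
      rw [← hh] at h1 h3
      have h5 := abs_lt.1 q2
      have h6 := abs_le.1 h3
      rw [abs_le]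
      constructor <;> linarith) (by
      -- Convexity enters here: `⟪x - y, ν(x)⟫ ≥ 0` since `y` lies in `K`, and `ν(x)` is close to
      -- `v₀`. Exchanging `x` and `y` gives the other bound.
      have aux : ∀ x ∈ boundaryDirection hK ⁻¹' ω, ∀ y : regularBoundary K,
          -(δ' * ‖(x : EuclideanSpace ℝ (Fin n)) - y‖) ≤
            ⟪(x : EuclideanSpace ℝ (Fin n)) - y, (v₀ : EuclideanSpace ℝ (Fin n))⟫ := by
        intro x hx y
        obtain ⟨⟨-, q1⟩, -⟩ := hball _ (hν x hx)
        have h1 := inner_le_sphereSupport (regularBoundary_subset y.2) (gaussMap K x)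
        have h2 := inner_gaussMap x
        have h3 := (abs_le.1 (hnv (gaussMap K x)
          ((x : EuclideanSpace ℝ (Fin n)) - y))).2
        have h4 : ‖(x : EuclideanSpace ℝ (Fin n)) - y‖ * dist (gaussMap K x) v₀ ≤
            δ' * ‖(x : EuclideanSpace ℝ (Fin n)) - y‖ := by
          rw [mul_comm]; gcongr
        rw [inner_sub_right, inner_sub_left, h2] at h3
        linarith
      rintro _ ⟨x, hx, rfl⟩ _ ⟨y, hy, rfl⟩
      rw [abs_le]
      refine ⟨aux x hx y, ?_⟩
      have := aux y hy x
      rw [norm_sub_rev, ← neg_sub (x : EuclideanSpace ℝ (Fin n)), inner_neg_left] at this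
      linarith)
    -- Discarding the irregular directions, a null set, leaves exactly the cone over `A`.
    have hM2 : (volume : Measure (EuclideanSpace ℝ (Fin n))).toSphere.withDensity
          (fun u => ENNReal.ofReal (wulffRadial h u ^ n)) ω =
        n * volume (Ioo (0 : ℝ) 1 • A) := by
      have h1 := volume_cone_radial hc hp (hω.inter hRm)
      rw [hdim] at h1
      have h2 : (fun u : sphere (0 : EuclideanSpace ℝ (Fin n)) 1 =>
          wulffRadial h u • (u : EuclideanSpace ℝ (Fin n))) = boundaryPoint K := rfl
      rw [hA, hAeq, ← h2, ← hh, h1, withDensity_apply _ hω]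
      refine setLIntegral_congr ?_
      filter_upwards [ae_mem_regularDirections hc hp] with u hu
      exact propext ⟨fun h => ⟨h, hu⟩, fun h => h.1⟩
    have hM1 : (supportSurfaceMeasure K).map (boundaryDirection hK) ω =
        ∫⁻ x in boundaryDirection hK ⁻¹' ω, ENNReal.ofReal (h (gaussMap K x))
          ∂(Measure.euclideanHausdorffMeasure (n - 1) : Measure (regularBoundary K)) := by
      rw [Measure.map_apply hdm hω, supportSurfaceMeasure, withDensity_apply _ (hdm hω)]
    have hHA : (Measure.euclideanHausdorffMeasure (n - 1) : Measure (regularBoundary K))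
        (boundaryDirection hK ⁻¹' ω) = μHE[n - 1] A :=
      (isometry_subtype_coe.euclideanHausdorffMeasure_image _).symm
    have hle1 : (supportSurfaceMeasure K).map (boundaryDirection hK) ω ≤
        L * (ENNReal.ofReal (h v₀) * μHE[n - 1] A) := by
      rw [hM1, ← hHA, ← mul_assoc, ← ENNReal.ofReal_coe_nnreal, ← ENNReal.ofReal_mul hL0.le,
        ← setLIntegral_const]
      refine setLIntegral_mono' (hdm hω) fun x hx => ?_
      exact ENNReal.ofReal_le_ofReal (hball _ (hν x hx)).2.2.1.le
    have hle2 : ENNReal.ofReal (h v₀) * μHE[n - 1] A ≤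
        L * (supportSurfaceMeasure K).map (boundaryDirection hK) ω := by
      have hmeas : Measurable fun x => ENNReal.ofReal (h (gaussMap K x)) :=
        (hc.measurable.comp hgm).ennreal_ofReal
      rw [hM1, ← hHA, ← setLIntegral_const, ← lintegral_const_mul _ hmeas]
      refine setLIntegral_mono' (hdm hω) fun x hx => ?_
      rw [← ENNReal.ofReal_coe_nnreal, ← ENNReal.ofReal_mul hL0.le]
      exact ENNReal.ofReal_le_ofReal (hball _ (hν x hx)).2.2.2.le
    rw [hM2]
    constructor
    · calc _ ≤ L * (ENNReal.ofReal (h v₀) * μHE[n - 1] A) := hle1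
        _ ≤ L * ((L : ℝ≥0∞) ^ (2 * n) * (n * volume (Ioo (0 : ℝ) 1 • A))) := by gcongr
        _ = _ := by ring
    · calc _ ≤ (L : ℝ≥0∞) ^ (2 * n) * (ENNReal.ofReal (h v₀) * μHE[n - 1] A) := H1
        _ ≤ (L : ℝ≥0∞) ^ (2 * n) *
            (L * (supportSurfaceMeasure K).map (boundaryDirection hK) ω) := by gcongr
        _ = _ := by ring
  have hνm := measurable_radialGaussMap hK
  refine le_antisymm ?_ ?_
  · refine measure_le_of_local_comparison hνm (2 * n + 1) fun L hL v₀ => ?_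
    obtain ⟨δ, hδ, h'⟩ := key L hL v₀
    exact ⟨δ, hδ, fun ω hω hωδ => (h' ω hω hωδ).1⟩
  · refine measure_le_of_local_comparison hνm (2 * n + 1) fun L hL v₀ => ?_
    obtain ⟨δ, hδ, h'⟩ := key L hL v₀
    exact ⟨δ, hδ, fun ω hω hωδ => (h' ω hω hωδ).2⟩

/-- The curvature measure as the image under the radial Gauss map of a measure with a bounded
density with respect to the spherical measure. -/
theorem dualCurvatureMeasure_eq_map [Nonempty (sphere (0 : EuclideanSpace ℝ (Fin n)) 1)]
    (p q : ℝ) (hK : K ∈ symmetricBodies n) :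
    dualCurvatureMeasure p q K = ((volume : Measure (EuclideanSpace ℝ (Fin n))).toSphere.withDensity
      fun u => ENNReal.ofReal (sphereSupport K (radialGaussMap K u) ^ (-p) *
        (wulffRadial (sphereSupport K) u ^ q *
          Real.exp (-wulffRadial (sphereSupport K) u ^ 2 / 2)))).map (radialGaussMap K) := by
  have hc := continuous_sphereSupport K
  have hp := sphereSupport_pos hK
  have hcρ := (continuous_wulffRadial hc hp).measurable
  have hρ := wulffRadial_pos hc hp
  have hνm := measurable_radialGaussMap hK
  have hgm := (continuous_gaussMap K).measurable
  have hdm := (continuous_boundaryDirection hK).measurable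
  have hhν := hc.measurable.comp hνm
  set k : sphere (0 : EuclideanSpace ℝ (Fin n)) 1 → ℝ≥0∞ := fun u =>
    ENNReal.ofReal (sphereSupport K (radialGaussMap K u) ^ (-p) *
      (wulffRadial (sphereSupport K) u ^ (q - n) *
        Real.exp (-wulffRadial (sphereSupport K) u ^ 2 / 2))) with hk
  have hkm : Measurable k := by
    refine Measurable.ennreal_ofReal ((hhν.pow_const _).mul ?_)
    fun_prop
  -- The identity `⟪x, ν⟫ ^ (1 - p) = h * h ^ (-p)` splits off the factor `h` that belongs to
  -- `supportSurfaceMeasure`.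
  have h1 : (Measure.euclideanHausdorffMeasure (n - 1) :
      Measure (regularBoundary K)).withDensity (fun x => ENNReal.ofReal
        (⟪(x : EuclideanSpace ℝ (Fin n)), (gaussMap K x : EuclideanSpace ℝ (Fin n))⟫ ^ (1 - p) *
          ‖(x : EuclideanSpace ℝ (Fin n))‖ ^ (q - n) *
          Real.exp (-‖(x : EuclideanSpace ℝ (Fin n))‖ ^ 2 / 2))) =
      (supportSurfaceMeasure K).withDensity (k ∘ boundaryDirection hK) := by
    have hsm : Measurable fun x => ENNReal.ofReal (sphereSupport K (gaussMap K x)) :=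
      (hc.measurable.comp hgm).ennreal_ofReal
    rw [supportSurfaceMeasure, ← withDensity_mul _ hsm (hkm.comp hdm)]
    congr 1
    funext x
    have hn : ‖(x : EuclideanSpace ℝ (Fin n))‖ =
        wulffRadial (sphereSupport K) (boundaryDirection hK x) := by
      rw [← norm_boundaryPoint hK, boundaryPoint_boundaryDirection hK]
    simp only [Pi.mul_apply, Function.comp_apply, hk]
    rw [inner_gaussMap, radialGaussMap_boundaryDirection, hn, ← ENNReal.ofReal_mul (hp _).le]
    congr 1
    rw [sub_eq_add_neg, Real.rpow_add (hp _), Real.rpow_one]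
    ring
  have h2 : (fun x : regularBoundary K => gaussMap K x) =
      radialGaussMap K ∘ boundaryDirection hK :=
    funext fun x => (radialGaussMap_boundaryDirection hK x).symm
  have h3 : ((supportSurfaceMeasure K).withDensity (k ∘ boundaryDirection hK)).map
      (boundaryDirection hK) =
      ((supportSurfaceMeasure K).map (boundaryDirection hK)).withDensity k := by
    ext ω hω
    rw [Measure.map_apply hdm hω, withDensity_apply _ (hdm hω), withDensity_apply _ hω,
      setLIntegral_map hω hkm hdm]
    rfl
  rw [dualCurvatureMeasure, h1, show gaussMap K = radialGaussMap K ∘ boundaryDirection hK from h2,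
    ← Measure.map_map hνm hdm, h3, map_boundaryDirection_supportSurfaceMeasure hK,
    ← withDensity_mul _ (by fun_prop) hkm]
  congr 2
  funext u
  simp only [Pi.mul_apply, hk]
  rw [← ENNReal.ofReal_mul (pow_nonneg (hρ u).le _)]
  congr 1
  have : wulffRadial (sphereSupport K) u ^ q =
      wulffRadial (sphereSupport K) u ^ n * wulffRadial (sphereSupport K) u ^ (q - n) := by
    rw [← Real.rpow_natCast, ← Real.rpow_add (hρ u)]
    congr 1
    ring
  rw [this]
  ring

end RegularBoundary

end GaussianDual

/-! ### Even measures on the sphere -/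

namespace GaussianDual

open Set Module Metric Filter Topology
open scoped NNReal Pointwise BoundedContinuousFunction

section Measures

theorem map_withDensity_comp {X Y : Type*} [MeasurableSpace X] [MeasurableSpace Y] {M : Measure X}
    {φ : X → Y} (hφ : Measurable φ) {k : Y → ℝ≥0∞} (hk : Measurable k) :
    (M.withDensity (k ∘ φ)).map φ = (M.map φ).withDensity k := by
  ext ω hω
  rw [Measure.map_apply hφ hω, withDensity_apply _ (hφ hω), withDensity_apply _ hω,
    setLIntegral_map hω hk hφ]
  rfl

theorem integral_pos_of_continuous_pos {X : Type*} [TopologicalSpace X] [CompactSpace X]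
    [MeasurableSpace X] [BorelSpace X] {M : Measure X} [IsFiniteMeasure M] (hM : M ≠ 0)
    {f : X → ℝ} (hf : Continuous f) (hpos : ∀ x, 0 < f x) : 0 < ∫ x, f x ∂M := by
  rw [integral_pos_iff_support_of_nonneg (fun x => (hpos x).le)
    (hf.integrable_of_hasCompactSupport (HasCompactSupport.of_compactSpace _))]
  have : Function.support f = univ := eq_univ_of_forall fun x => (hpos x).ne'
  rw [this]
  exact (Measure.measure_univ_pos).2 hM

theorem inv_measure_univ_smul_eq {X : Type*} [MeasurableSpace X] {μ₁ μ₂ : Measure X} {a b : ℝ≥0∞}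
    (ha : a ≠ 0) (ha' : a ≠ ⊤) (hb : b ≠ 0) (hb' : b ≠ ⊤) (h : a • μ₁ = b • μ₂) :
    (μ₁ univ)⁻¹ • μ₁ = (μ₂ univ)⁻¹ • μ₂ := by
  have h1 : μ₁ = (a⁻¹ * b) • μ₂ := by
    rw [mul_smul, ← h, smul_smul, ENNReal.inv_mul_cancel ha ha', one_smul]
  have hk : a⁻¹ * b ≠ 0 := mul_ne_zero (ENNReal.inv_ne_zero.2 ha') hb
  have hk' : a⁻¹ * b ≠ ⊤ := ENNReal.mul_ne_top (ENNReal.inv_ne_top.2 ha) hb'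
  rw [h1, Measure.smul_apply, smul_eq_mul, smul_smul, ENNReal.mul_inv (Or.inl hk) (Or.inl hk'),
    mul_comm (_)⁻¹, mul_assoc, ENNReal.inv_mul_cancel hk hk', mul_one]

variable {E : Type*} [NormedAddCommGroup E] [InnerProductSpace ℝ E] [FiniteDimensional ℝ E]
  [MeasurableSpace E] [BorelSpace E]

/-- Against an even measure, a function and its even part have the same integral. -/
theorem ext_of_forall_even_integral_eq {m₁ m₂ : Measure (sphere (0 : E) 1)} [IsFiniteMeasure m₁]
    [IsFiniteMeasure m₂] (h₁ : m₁.map (fun v => -v) = m₁) (h₂ : m₂.map (fun v => -v) = m₂)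
    (h : ∀ g : sphere (0 : E) 1 → ℝ, Continuous g → (∀ v, g (-v) = g v) →
      ∫ v, g v ∂m₁ = ∫ v, g v ∂m₂) : m₁ = m₂ := by
  refine ext_of_forall_integral_eq_of_IsFiniteMeasure fun f => ?_
  have key : ∀ m : Measure (sphere (0 : E) 1), IsFiniteMeasure m → m.map (fun v => -v) = m →
      ∫ v, f v ∂m = (1 / 2) * ∫ v, (f v + f (-v)) ∂m := by
    intro m _ hm
    have hc : Continuous fun v : sphere (0 : E) 1 => f (-v) := f.continuous.comp continuous_neg
    have h1 : ∫ v, f (-v) ∂m = ∫ v, f v ∂m := by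
      conv_rhs => rw [← hm]
      rw [integral_map continuous_neg.measurable.aemeasurable f.continuous.aestronglyMeasurable]
    rw [integral_add (f.continuous.integrable_of_hasCompactSupport
      (HasCompactSupport.of_compactSpace _)) (hc.integrable_of_hasCompactSupport
      (HasCompactSupport.of_compactSpace _)), h1]
    ring
  rw [key m₁ inferInstance h₁, key m₂ inferInstance h₂]
  congr 1
  refine h _ (f.continuous.add (f.continuous.comp continuous_neg)) fun v => ?_
  rw [neg_neg, add_comm]

theorem toSphere_map_neg : (volume : Measure E).toSphere.map (fun v => -v) =
    (volume : Measure E).toSphere := by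
  ext ω hω
  have hm : Measurable fun v : sphere (0 : E) 1 => -v := continuous_neg.measurable
  rw [Measure.map_apply hm hω, Measure.toSphere_apply' _ (hm hω), Measure.toSphere_apply' _ hω]
  congr 1
  rw [← Measure.measure_neg]
  congr 1
  ext x
  simp only [Set.mem_neg, Set.mem_smul]
  constructor
  · rintro ⟨r, hr, _, ⟨u, hu, rfl⟩, h⟩
    refine ⟨r, hr, _, ⟨-u, hu, rfl⟩, ?_⟩
    rw [← neg_neg x, ← h]
    simp
  · rintro ⟨r, hr, _, ⟨u, hu, rfl⟩, rfl⟩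
    refine ⟨r, hr, _, ⟨-u, by simpa using hu, rfl⟩, ?_⟩
    simp

end Measures

/-! ### Evenness, finiteness and change of exponent for the curvature measure -/

section Even

variable {E : Type*} [NormedAddCommGroup E] [InnerProductSpace ℝ E] [FiniteDimensional ℝ E]
  {f : sphere (0 : E) 1 → ℝ}

theorem wulffRadial_neg [Nonempty (sphere (0 : E) 1)] (hf : Continuous f) (hpos : ∀ v, 0 < f v)
    (heven : ∀ v, f (-v) = f v) (u : sphere (0 : E) 1) : wulffRadial f (-u) = wulffRadial f u := by
  have key : ∀ x : E, wulffGauge f (-x) ≤ wulffGauge f x := fun x => by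
    rw [wulffGauge_le_iff hf hpos]
    intro v
    have := (wulffGauge_le_iff hf hpos).1 (le_refl (wulffGauge f x)) (-v)
    rw [heven] at this
    simpa using this
  rw [wulffRadial, wulffRadial, coe_neg_sphere]
  exact congrArg _ (le_antisymm (key u) (by simpa using key (-u)))

variable {n : ℕ} {K : ConvexBody (EuclideanSpace ℝ (Fin n))}

theorem radialGaussMap_neg (hK : K ∈ symmetricBodies n)
    {u : sphere (0 : EuclideanSpace ℝ (Fin n)) 1}
    (hu : u ∈ regularDirections (sphereSupport K)) :
    radialGaussMap K (-u) = -radialGaussMap K u := by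
  have : Nonempty (sphere (0 : EuclideanSpace ℝ (Fin n)) 1) := ⟨u⟩
  have hc := continuous_sphereSupport K
  have hp := sphereSupport_pos hK
  have hρ := wulffRadial_neg hc hp (sphereSupport_neg hK) u
  have key : ∀ v : sphere (0 : EuclideanSpace ℝ (Fin n)) 1,
      ⟪wulffRadial (sphereSupport K) (-u) • ((-u : sphere (0 : EuclideanSpace ℝ (Fin n)) 1) :
        EuclideanSpace ℝ (Fin n)), (v : EuclideanSpace ℝ (Fin n))⟫ = sphereSupport K v ↔
      ⟪wulffRadial (sphereSupport K) u • (u : EuclideanSpace ℝ (Fin n)),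
        ((-v : sphere (0 : EuclideanSpace ℝ (Fin n)) 1) : EuclideanSpace ℝ (Fin n))⟫ =
          sphereSupport K (-v) := fun v => by
    rw [hρ, sphereSupport_neg hK, coe_neg_sphere, coe_neg_sphere, smul_neg, inner_neg_left,
      inner_neg_right]
  have hu' : -u ∈ regularDirections (sphereSupport K) := fun v w hv hw =>
    neg_injective (hu _ _ ((key v).1 hv) ((key w).1 hw))
  obtain ⟨v, hv⟩ := exists_inner_radial_smul_eq hc hp (-u)
  rw [← eq_radialGaussMap hK hu' hv, ← eq_radialGaussMap hK hu ((key v).1 hv), neg_neg]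

/-- The density of the curvature measure on the sphere of directions. -/
noncomputable def radialCurvatureDensity (p q : ℝ) (K : ConvexBody (EuclideanSpace ℝ (Fin n)))
    (u : sphere (0 : EuclideanSpace ℝ (Fin n)) 1) : ℝ :=
  sphereSupport K (radialGaussMap K u) ^ (-p) * (wulffRadial (sphereSupport K) u ^ q *
    Real.exp (-wulffRadial (sphereSupport K) u ^ 2 / 2))

theorem radialCurvatureDensity_pos (p q : ℝ) (hK : K ∈ symmetricBodies n)
    (u : sphere (0 : EuclideanSpace ℝ (Fin n)) 1) : 0 < radialCurvatureDensity p q K u :=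
  mul_pos (Real.rpow_pos_of_pos (sphereSupport_pos hK _) _) (mul_pos (Real.rpow_pos_of_pos
    (wulffRadial_pos (continuous_sphereSupport K) (sphereSupport_pos hK) u) _) (Real.exp_pos _))

theorem measurable_radialCurvatureDensity (p q : ℝ) (hK : K ∈ symmetricBodies n) :
    Measurable (radialCurvatureDensity p q K) := by
  have hc := continuous_sphereSupport K
  have hρ := (continuous_wulffRadial hc (sphereSupport_pos hK)).measurable
  refine ((hc.measurable.comp (measurable_radialGaussMap hK)).pow_const _).mul ?_
  fun_prop

variable [Nonempty (sphere (0 : EuclideanSpace ℝ (Fin n)) 1)]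

omit [Nonempty (sphere (0 : EuclideanSpace ℝ (Fin n)) 1)] in
theorem integrable_radialCurvatureDensity (p q : ℝ) (hK : K ∈ symmetricBodies n) :
    Integrable (radialCurvatureDensity p q K)
      (volume : Measure (EuclideanSpace ℝ (Fin n))).toSphere := by
  have hc := continuous_sphereSupport K
  have hp := sphereSupport_pos hK
  have hρ := continuous_wulffRadial hc hp
  have hφ : Continuous fun v => sphereSupport K v ^ (-p) :=
    hc.rpow_const fun v => Or.inl (hp v).ne'
  have hψ : Continuous fun u => wulffRadial (sphereSupport K) u ^ q *
      Real.exp (-wulffRadial (sphereSupport K) u ^ 2 / 2) :=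
    (hρ.rpow_const fun v => Or.inl (wulffRadial_pos hc hp v).ne').mul (by fun_prop)
  obtain ⟨C, hC⟩ := isCompact_univ.exists_bound_of_continuousOn hφ.continuousOn
  obtain ⟨D, hD⟩ := isCompact_univ.exists_bound_of_continuousOn hψ.continuousOn
  refine Integrable.of_bound (measurable_radialCurvatureDensity p q hK).aestronglyMeasurable
    (C * D) (ae_of_all _ fun u => ?_)
  rw [radialCurvatureDensity, norm_mul]
  exact mul_le_mul (hC _ (mem_univ _)) (hD u (mem_univ _)) (norm_nonneg _)
    ((norm_nonneg _).trans (hC u (mem_univ _)))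

theorem dualCurvatureMeasure_eq (p q : ℝ) (hK : K ∈ symmetricBodies n) :
    dualCurvatureMeasure p q K = ((volume : Measure (EuclideanSpace ℝ (Fin n))).toSphere.withDensity
      fun u => ENNReal.ofReal (radialCurvatureDensity p q K u)).map (radialGaussMap K) :=
  dualCurvatureMeasure_eq_map p q hK

theorem isFiniteMeasure_dualCurvatureMeasure (p q : ℝ) (hK : K ∈ symmetricBodies n) :
    IsFiniteMeasure (dualCurvatureMeasure p q K) := by
  have := isFiniteMeasure_withDensity_ofReal (integrable_radialCurvatureDensity p q hK).2
  rw [dualCurvatureMeasure_eq p q hK]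
  infer_instance

theorem dualCurvatureMeasure_ne_zero (p q : ℝ) (hK : K ∈ symmetricBodies n) :
    dualCurvatureMeasure p q K ≠ 0 := by
  obtain ⟨u₀⟩ := ‹Nonempty (sphere (0 : EuclideanSpace ℝ (Fin n)) 1)›
  have : Nonempty (sphere (0 : EuclideanSpace ℝ (Fin n)) 1) := ⟨u₀⟩
  have : Nontrivial (EuclideanSpace ℝ (Fin n)) := ⟨⟨u₀, 0, ne_of_apply_ne Norm.norm (by simp)⟩⟩
  have hm := (measurable_radialCurvatureDensity p q hK).ennreal_ofReal
  rw [dualCurvatureMeasure_eq p q hK, Ne,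
    Measure.map_eq_zero_iff (measurable_radialGaussMap hK).aemeasurable,
    withDensity_eq_zero_iff hm.aemeasurable]
  intro h
  have h1 : ∀ᵐ u ∂(volume : Measure (EuclideanSpace ℝ (Fin n))).toSphere, False := by
    filter_upwards [h] with u hu
    exact (ENNReal.ofReal_pos.2 (radialCurvatureDensity_pos p q hK u)).ne' hu
  rw [eventually_false_iff_eq_bot, ae_eq_bot] at h1
  exact Measure.toSphere_ne_zero _ h1

theorem integral_dualCurvatureMeasure (p q : ℝ) (hK : K ∈ symmetricBodies n)
    {g : sphere (0 : EuclideanSpace ℝ (Fin n)) 1 → ℝ} (hg : Continuous g) :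
    ∫ v, g v ∂(dualCurvatureMeasure p q K) = ∫ u, radialCurvatureDensity p q K u *
      g (radialGaussMap K u) ∂(volume : Measure (EuclideanSpace ℝ (Fin n))).toSphere := by
  rw [dualCurvatureMeasure_eq p q hK, integral_map (measurable_radialGaussMap hK).aemeasurable
    hg.aestronglyMeasurable, integral_withDensity_eq_integral_toReal_smul
    (measurable_radialCurvatureDensity p q hK).ennreal_ofReal
    (ae_of_all _ fun _ => ENNReal.ofReal_lt_top)]
  refine integral_congr_ae (ae_of_all _ fun u => ?_)
  simp only [ENNReal.toReal_ofReal (radialCurvatureDensity_pos p q hK u).le, smul_eq_mul]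

/-- Almost everywhere the density is even and the radial Gauss map is odd, and the spherical measure
is invariant under the antipodal map. -/
theorem dualCurvatureMeasure_map_neg (p q : ℝ) (hK : K ∈ symmetricBodies n) :
    (dualCurvatureMeasure p q K).map (fun v => -v) = dualCurvatureMeasure p q K := by
  have hneg : Measurable fun v : sphere (0 : EuclideanSpace ℝ (Fin n)) 1 => -v :=
    continuous_neg.measurable
  have hνm := measurable_radialGaussMap hK
  have hm := (measurable_radialCurvatureDensity p q hK).ennreal_ofReal
  have hae := ae_mem_regularDirections (continuous_sphereSupport K) (sphereSupport_pos hK)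
  have h1 : (volume : Measure (EuclideanSpace ℝ (Fin n))).toSphere.withDensity
      (fun u => ENNReal.ofReal (radialCurvatureDensity p q K u)) =
      (volume : Measure (EuclideanSpace ℝ (Fin n))).toSphere.withDensity
      ((fun u => ENNReal.ofReal (radialCurvatureDensity p q K u)) ∘ fun v => -v) := by
    refine withDensity_congr_ae ?_
    filter_upwards [hae] with u hu
    simp only [Function.comp_apply, radialCurvatureDensity, radialGaussMap_neg hK hu,
      sphereSupport_neg hK,
      wulffRadial_neg (continuous_sphereSupport K) (sphereSupport_pos hK) (sphereSupport_neg hK)]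
  have h2 : ((volume : Measure (EuclideanSpace ℝ (Fin n))).toSphere.withDensity
      (fun u => ENNReal.ofReal (radialCurvatureDensity p q K u))).map (fun v => -v) =
      (volume : Measure (EuclideanSpace ℝ (Fin n))).toSphere.withDensity
      (fun u => ENNReal.ofReal (radialCurvatureDensity p q K u)) := by
    conv_lhs => rw [h1]
    rw [map_withDensity_comp hneg hm, toSphere_map_neg]
  rw [dualCurvatureMeasure_eq p q hK, Measure.map_map hneg hνm]
  conv_rhs => rw [← h2, Measure.map_map hνm hneg]
  refine Measure.map_congr ?_
  filter_upwards [(withDensity_absolutelyContinuous _ _).ae_le hae] with u hu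
  exact (radialGaussMap_neg hK hu).symm

/-- This reduces the problem to `p = 1`, the curvature measure that the first variation of the mass
produces. -/
theorem dualCurvatureMeasure_withDensity (p q : ℝ) (hK : K ∈ symmetricBodies n) :
    (dualCurvatureMeasure 1 q K).withDensity (fun v => ENNReal.ofReal (sphereSupport K v ^ (1 - p))) =
      dualCurvatureMeasure p q K := by
  have hc := continuous_sphereSupport K
  have hk : Measurable fun v => ENNReal.ofReal (sphereSupport K v ^ (1 - p)) :=
    (hc.measurable.pow_const _).ennreal_ofReal
  have hνm := measurable_radialGaussMap hK
  rw [dualCurvatureMeasure_eq 1 q hK, dualCurvatureMeasure_eq p q hK,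
    ← map_withDensity_comp hνm hk,
    ← withDensity_mul _ (measurable_radialCurvatureDensity 1 q hK).ennreal_ofReal (hk.comp hνm)]
  congr 2
  funext u
  have hp := sphereSupport_pos hK (radialGaussMap K u)
  simp only [Pi.mul_apply, Function.comp_apply]
  rw [← ENNReal.ofReal_mul (radialCurvatureDensity_pos 1 q hK u).le]
  congr 1
  rw [radialCurvatureDensity, radialCurvatureDensity, show -p = -1 + (1 - p) by ring,
    Real.rpow_add hp]
  ring

end Even

end GaussianDual

/-! ### The maximizer and its Euler–Lagrange equation -/

namespace GaussianDual

open Set Module Metric Filter Topology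
open scoped NNReal Pointwise

section Maximizer

variable {n : ℕ} [Nonempty (sphere (0 : EuclideanSpace ℝ (Fin n)) 1)]

/-- The dual quermassintegral of a Wulff shape, in terms of its radial function. -/
noncomputable def wulffMass (q : ℝ) (f : sphere (0 : EuclideanSpace ℝ (Fin n)) 1 → ℝ) : ℝ :=
  ∫ u, radialMass q (wulffRadial f u) ∂(volume : Measure (EuclideanSpace ℝ (Fin n))).toSphere

theorem dualQuermassintegral_wulffBody {q : ℝ} (hq : 1 < q)
    {f : sphere (0 : EuclideanSpace ℝ (Fin n)) 1 → ℝ} (hf : Continuous f) (hpos : ∀ v, 0 < f v) :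
    dualQuermassintegral q (wulffBody f hf hpos) = ENNReal.ofReal (wulffMass q f) := by
  have h1 := setLIntegral_wulffBody hq hf hpos
  rw [finrank_euclideanSpace_fin] at h1
  have hc : Continuous fun u => radialMass q (wulffRadial f u) :=
    (continuous_radialMass hq).comp (continuous_wulffRadial hf hpos)
  rw [dualQuermassintegral, h1, wulffMass, ofReal_integral_eq_lintegral_ofReal
    (hc.integrable_of_hasCompactSupport (HasCompactSupport.of_compactSpace _))
    (ae_of_all _ fun u => radialMass_nonneg q (wulffRadial_pos hf hpos u).le)]

theorem exists_const_mul_wulffMass_eq {q : ℝ} (hq : 1 < q)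
    {f : sphere (0 : EuclideanSpace ℝ (Fin n)) 1 → ℝ} (hf : Continuous f) (hpos : ∀ v, 0 < f v)
    {m : ℝ} (hm : 0 < m) (hmf : m ≤ wulffMass q f) :
    ∃ k ∈ Ioc (0 : ℝ) 1, wulffMass q (fun v => k * f v) = m := by
  have hρ := continuous_wulffRadial hf hpos
  have hcont : Continuous fun k : ℝ => ∫ u, radialMass q (k * wulffRadial f u)
      ∂(volume : Measure (EuclideanSpace ℝ (Fin n))).toSphere := by
    have := continuous_parametric_integral_of_continuous
      (μ := (volume : Measure (EuclideanSpace ℝ (Fin n))).toSphere)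
      (f := fun (k : ℝ) u => radialMass q (k * wulffRadial f u))
      ((continuous_radialMass hq).comp (by fun_prop)) isCompact_univ
    simpa only [Measure.restrict_univ] using this
  -- The mass is 0 at `k = 0` and that of `f` at `k = 1`.
  obtain ⟨k, hk, hkm⟩ := intermediate_value_Icc (zero_le_one (α := ℝ)) hcont.continuousOn
    (show m ∈ Icc _ _ from ⟨by simpa [radialMass] using hm.le, by simpa [wulffMass] using hmf⟩)
  have hk0 : 0 < k := by
    refine lt_of_le_of_ne hk.1 fun h => ?_
    subst h
    simp [radialMass] at hkm
    exact hm.ne hkm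
  refine ⟨k, ⟨hk0, hk.2⟩, ?_⟩
  simp only [wulffMass, wulffRadial_const_mul hf hpos hk0]
  exact hkm

omit [Nonempty (sphere (0 : EuclideanSpace ℝ (Fin n)) 1)] in
theorem sphereSupport_wulffBody_le {f : sphere (0 : EuclideanSpace ℝ (Fin n)) 1 → ℝ}
    (hf : Continuous f) (hpos : ∀ v, 0 < f v) (v : sphere (0 : EuclideanSpace ℝ (Fin n)) 1) :
    sphereSupport (wulffBody f hf hpos) v ≤ f v :=
  sphereSupport_le fun _ hx => (mem_wulffBody hf hpos).1 hx v

theorem wulffBody_mem_symmetricBodies {f : sphere (0 : EuclideanSpace ℝ (Fin n)) 1 → ℝ}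
    (hf : Continuous f) (hpos : ∀ v, 0 < f v) (heven : ∀ v, f (-v) = f v) :
    wulffBody f hf hpos ∈ symmetricBodies n := by
  refine ⟨interior_wulffBody_nonempty hf hpos, fun x hx v => ?_⟩
  have := hx (-v)
  rw [heven] at this
  simpa using this

variable {p q : ℝ} {μ : Measure (sphere (0 : EuclideanSpace ℝ (Fin n)) 1)} [IsFiniteMeasure μ]
  {K : ConvexBody (EuclideanSpace ℝ (Fin n))}

/-- Removes the volume constraint and the Wulff shape from the maximality. Scaling `f` by some `k ≤
1` restores the prescribed mass, and the support function of the resulting body is at most `k * f ≤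
f`. -/
theorem integral_sphereSupport_rpow_le (hp : 1 < p) (hq : 1 < q) (hμ : μ ≠ 0)
    (hK : K ∈ symmetricBodies n) (hvol : dualQuermassintegral q K = μ univ)
    (hmax : IsMaxOn (functionalPhi p μ)
      {K | K ∈ symmetricBodies n ∧ dualQuermassintegral q K = μ univ} K)
    {f : sphere (0 : EuclideanSpace ℝ (Fin n)) 1 → ℝ} (hf : Continuous f) (hpos : ∀ v, 0 < f v)
    (heven : ∀ v, f (-v) = f v) (hmass : wulffMass q (sphereSupport K) ≤ wulffMass q f) :
    ∫ v, sphereSupport K v ^ p ∂μ ≤ ∫ v, f v ^ p ∂μ := by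
  have hKmass : ENNReal.ofReal (wulffMass q (sphereSupport K)) = μ univ := by
    rw [← hvol, ← dualQuermassintegral_wulffBody hq (continuous_sphereSupport K)
      (sphereSupport_pos hK), wulffBody_sphereSupport hK]
  have hμ0 : 0 < μ univ := Measure.measure_univ_pos.2 hμ
  have hm : 0 < wulffMass q (sphereSupport K) := by
    rwa [← hKmass, ENNReal.ofReal_pos] at hμ0
  obtain ⟨k, hk, hkm⟩ := exists_const_mul_wulffMass_eq hq hf hpos hm hmass
  have hkf : Continuous fun v => k * f v := by fun_prop
  have hkp : ∀ v, 0 < k * f v := fun v => mul_pos hk.1 (hpos v)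
  set K' := wulffBody (fun v => k * f v) hkf hkp with hK'
  have hK's : K' ∈ symmetricBodies n :=
    wulffBody_mem_symmetricBodies hkf hkp fun v => by rw [heven]
  have h1 : functionalPhi p μ K' ≤ functionalPhi p μ K :=
    hmax ⟨hK's, by rw [hK', dualQuermassintegral_wulffBody hq hkf hkp, hkm, hKmass]⟩
  have hden : 0 < p * μ.real univ :=
    mul_pos (by linarith) (ENNReal.toReal_pos hμ0.ne' (measure_ne_top _ _))
  rw [functionalPhi, functionalPhi, div_le_div_iff_of_pos_right hden, neg_le_neg_iff] at h1
  refine h1.trans (integral_mono ?_ ?_ fun v => ?_)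
  · exact ((continuous_sphereSupport K').rpow_const fun v => Or.inr (by linarith)
      ).integrable_of_hasCompactSupport (HasCompactSupport.of_compactSpace _)
  · exact (hf.rpow_const fun v => Or.inr (by linarith)
      ).integrable_of_hasCompactSupport (HasCompactSupport.of_compactSpace _)
  · refine Real.rpow_le_rpow (sphereSupport_pos hK's v).le ?_ (by linarith)
    refine (sphereSupport_wulffBody_le hkf hkp v).trans ?_
    exact mul_le_of_le_one_left (hpos v).le hk.2

theorem hasDerivAt_integral_rpow (hp : 1 < p)
    {h g : sphere (0 : EuclideanSpace ℝ (Fin n)) 1 → ℝ} (hh : Continuous h)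
    (hpos : ∀ v, 0 < h v) (hg : Continuous g) :
    HasDerivAt (fun t : ℝ => ∫ v, (h v + t * g v) ^ p ∂μ)
      (∫ v, g v * p * h v ^ (p - 1) ∂μ) 0 := by
  obtain ⟨a, ha, b, M, hM, t₀, ht₀, hgM, hab⟩ := exists_perturbation_bounds hh hpos hg
  have hmem : ∀ t ∈ ball (0 : ℝ) t₀, |t| < t₀ := fun t ht => by simpa using ht
  have hc : ∀ t : ℝ, Continuous fun v => (h v + t * g v) ^ p := fun t =>
    Continuous.rpow_const (by fun_prop) fun v => Or.inr (by linarith)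
  have hb : 0 ≤ b := by
    obtain ⟨u⟩ := ‹Nonempty (sphere (0 : EuclideanSpace ℝ (Fin n)) 1)›
    have := hab 0 (by simpa using ht₀) u
    linarith
  have key := (hasDerivAt_integral_of_dominated_loc_of_deriv_le (μ := μ)
    (F := fun (t : ℝ) v => (h v + t * g v) ^ p)
    (F' := fun (t : ℝ) v => g v * p * (h v + t * g v) ^ (p - 1))
    (bound := fun _ => M * p * b ^ (p - 1)) (ball_mem_nhds (0 : ℝ) ht₀)
    (Eventually.of_forall fun t => (hc t).aestronglyMeasurable)
    ((hc 0).integrable_of_hasCompactSupport (HasCompactSupport.of_compactSpace _))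
    (Continuous.aestronglyMeasurable (by
      refine Continuous.mul (by fun_prop) (Continuous.rpow_const (by fun_prop) fun v => Or.inr ?_)
      linarith))
    (ae_of_all _ fun v t ht => ?_) (integrable_const _) (ae_of_all _ fun v t ht => ?_)).2
  · simpa using key
  · have h1 := hab t (hmem t ht) v
    rw [norm_mul, norm_mul, Real.norm_eq_abs, Real.norm_of_nonneg (by linarith : 0 ≤ p),
      Real.norm_of_nonneg (Real.rpow_nonneg (by linarith) _)]
    exact mul_le_mul (mul_le_mul_of_nonneg_right (hgM v) (by linarith))
      (Real.rpow_le_rpow (by linarith) h1.2 (by linarith))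
      (Real.rpow_nonneg (by linarith) _) (mul_nonneg hM.le (by linarith))
  · have h1 := hab t (hmem t ht) v
    have h2 : HasDerivAt (fun t : ℝ => h v + t * g v) (g v) t := by
      simpa using ((hasDerivAt_id t).mul_const (g v)).const_add (h v)
    exact h2.rpow_const (Or.inl (by linarith))

theorem hasDerivAt_wulffMass (hq : 1 < q) (hK : K ∈ symmetricBodies n)
    {g : sphere (0 : EuclideanSpace ℝ (Fin n)) 1 → ℝ} (hg : Continuous g) :
    HasDerivAt (fun t : ℝ => wulffMass q (fun v => sphereSupport K v + t * g v))
      (∫ v, g v ∂(dualCurvatureMeasure 1 q K)) 0 := by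
  have hc := continuous_sphereSupport K
  have hp := sphereSupport_pos hK
  have h1 := hasDerivAt_integral_radialMass hq hc hp hg
    (σ := (volume : Measure (EuclideanSpace ℝ (Fin n))).toSphere)
    (measurable_radialGaussMap hK).aemeasurable (by
      filter_upwards [ae_mem_regularDirections hc hp] with u hu v hv
      exact eq_radialGaussMap hK hu hv)
  refine h1.congr_deriv ?_
  rw [integral_dualCurvatureMeasure 1 q hK hg]
  refine integral_congr_ae (ae_of_all _ fun u => ?_)
  have hρ := wulffRadial_pos hc hp u
  simp only [radialCurvatureDensity]
  rw [Real.rpow_neg_one, Real.rpow_sub_one hρ.ne']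
  field_simp

theorem exists_pos_lt_of_hasDerivAt {φ : ℝ → ℝ} {d : ℝ} (h : HasDerivAt φ d 0) (hd : 0 < d) :
    ∀ᶠ t in 𝓝[>] (0 : ℝ), φ 0 < φ t := by
  filter_upwards [h.tendsto_slope_zero_right.eventually_const_lt hd, self_mem_nhdsWithin]
    with t ht ht0
  rw [zero_add, smul_eq_mul, inv_mul_eq_div, div_pos_iff_of_pos_right ht0] at ht
  linarith

/-- Otherwise, for small `t > 0`, the function `h + t g` would have larger mass and a smaller
integral of its `p`-th power, against `integral_sphereSupport_rpow_le`. -/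
theorem integral_nonneg_of_integral_dualCurvatureMeasure_pos (hp : 1 < p) (hq : 1 < q) (hμ : μ ≠ 0)
    (hK : K ∈ symmetricBodies n) (hvol : dualQuermassintegral q K = μ univ)
    (hmax : IsMaxOn (functionalPhi p μ)
      {K | K ∈ symmetricBodies n ∧ dualQuermassintegral q K = μ univ} K)
    {g : sphere (0 : EuclideanSpace ℝ (Fin n)) 1 → ℝ} (hg : Continuous g)
    (heven : ∀ v, g (-v) = g v) (hD : 0 < ∫ v, g v ∂(dualCurvatureMeasure 1 q K)) :
    0 ≤ ∫ v, g v * sphereSupport K v ^ (p - 1) ∂μ := by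
  by_contra! hS
  have hc := continuous_sphereSupport K
  have hpos := sphereSupport_pos hK
  have h1 := exists_pos_lt_of_hasDerivAt (hasDerivAt_wulffMass hq hK hg) hD
  have h2 := exists_pos_lt_of_hasDerivAt (hasDerivAt_integral_rpow (μ := μ) hp hc hpos hg).neg (by
    have : ∫ v, g v * p * sphereSupport K v ^ (p - 1) ∂μ =
        p * ∫ v, g v * sphereSupport K v ^ (p - 1) ∂μ := by
      rw [← integral_const_mul]
      exact integral_congr_ae (ae_of_all _ fun v => by ring)
    rw [this]
    have : 0 < p := by linarith
    nlinarith)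
  obtain ⟨a, ha, b, M, hM, t₀, ht₀, -, hab⟩ := exists_perturbation_bounds hc hpos hg
  have h3 : ∀ᶠ t in 𝓝[>] (0 : ℝ), t ∈ ball (0 : ℝ) t₀ :=
    nhdsWithin_le_nhds (ball_mem_nhds 0 ht₀)
  obtain ⟨t, ⟨ht1, ht2⟩, ht3⟩ := ((h1.and h2).and h3).exists
  have ht3' : |t| < t₀ := by simpa using ht3
  have h4 := integral_sphereSupport_rpow_le hp hq hμ hK hvol hmax
    (f := fun v => sphereSupport K v + t * g v) (by fun_prop)
    (fun v => ha.trans_le (hab t ht3' v).1)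
    (fun v => by rw [heven, sphereSupport_neg hK]) (by simpa using ht1.le)
  simp only [Pi.neg_apply, zero_mul, add_zero] at ht2
  linarith

/-- Linear algebra: `D > 0` implies `S ≥ 0` for two linear functionals, and `D` is positive at `h`.
The combinations `±(D(h) g - D(g) h) + δ h` have `D = δ D(h) > 0`; letting `δ` tend to 0 in the
inequality for `S` gives both directions. -/
theorem integral_mul_eq_integral_mul (hp : 1 < p) (hq : 1 < q) (hμ : μ ≠ 0)
    (hK : K ∈ symmetricBodies n) (hvol : dualQuermassintegral q K = μ univ)
    (hmax : IsMaxOn (functionalPhi p μ)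
      {K | K ∈ symmetricBodies n ∧ dualQuermassintegral q K = μ univ} K)
    {g : sphere (0 : EuclideanSpace ℝ (Fin n)) 1 → ℝ} (hg : Continuous g)
    (heven : ∀ v, g (-v) = g v) :
    (∫ v, sphereSupport K v ∂(dualCurvatureMeasure 1 q K)) *
        ∫ v, g v * sphereSupport K v ^ (p - 1) ∂μ =
      (∫ v, sphereSupport K v * sphereSupport K v ^ (p - 1) ∂μ) *
        ∫ v, g v ∂(dualCurvatureMeasure 1 q K) := by
  have hc := continuous_sphereSupport K
  have hpos := sphereSupport_pos hK
  have := isFiniteMeasure_dualCurvatureMeasure 1 q hK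
  set D := fun g : sphere (0 : EuclideanSpace ℝ (Fin n)) 1 → ℝ =>
    ∫ v, g v ∂(dualCurvatureMeasure 1 q K) with hDdef
  set S := fun g : sphere (0 : EuclideanSpace ℝ (Fin n)) 1 → ℝ =>
    ∫ v, g v * sphereSupport K v ^ (p - 1) ∂μ with hSdef
  have hpc : Continuous fun v => sphereSupport K v ^ (p - 1) :=
    hc.rpow_const fun v => Or.inl (hpos v).ne'
  have hDlin : ∀ a b : ℝ, D (fun v => a * g v + b * sphereSupport K v) =
      a * D g + b * D (sphereSupport K) := fun a b => by
    simp only [hDdef]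
    rw [integral_add, integral_const_mul, integral_const_mul]
    · exact Continuous.integrable_of_hasCompactSupport (by fun_prop)
        (HasCompactSupport.of_compactSpace _)
    · exact Continuous.integrable_of_hasCompactSupport (by fun_prop)
        (HasCompactSupport.of_compactSpace _)
  have hSlin : ∀ a b : ℝ, S (fun v => a * g v + b * sphereSupport K v) =
      a * S g + b * S (sphereSupport K) := fun a b => by
    simp only [hSdef, add_mul, mul_assoc]
    rw [integral_add, integral_const_mul, integral_const_mul]
    · exact Continuous.integrable_of_hasCompactSupport (by fun_prop)
        (HasCompactSupport.of_compactSpace _)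
    · exact Continuous.integrable_of_hasCompactSupport (by fun_prop)
        (HasCompactSupport.of_compactSpace _)
  have hDh : 0 < D (sphereSupport K) :=
    integral_pos_of_continuous_pos (dualCurvatureMeasure_ne_zero 1 q hK) hc hpos
  have key : ∀ a b : ℝ, 0 < a * D g + b * D (sphereSupport K) →
      0 ≤ a * S g + b * S (sphereSupport K) := fun a b hab => by
    rw [← hSlin]
    refine integral_nonneg_of_integral_dualCurvatureMeasure_pos hp hq hμ hK hvol hmax
      (g := fun v => a * g v + b * sphereSupport K v) (by fun_prop)
      (fun v => by rw [heven, sphereSupport_neg hK]) ?_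
    exact hab.trans_eq (hDlin a b).symm
  have lim : ∀ x y : ℝ, (∀ δ > 0, 0 ≤ x + δ * y) → 0 ≤ x := fun x y hxy => by
    have ht : Tendsto (fun δ : ℝ => x + δ * y) (𝓝[>] 0) (𝓝 x) := by
      refine (Continuous.tendsto' (by fun_prop) _ _ (by simp)).mono_left nhdsWithin_le_nhds
    exact ge_of_tendsto ht (by filter_upwards [self_mem_nhdsWithin] with δ hδ using hxy δ hδ)
  change D (sphereSupport K) * S g = S (sphereSupport K) * D g
  refine le_antisymm ?_ ?_
  · have := lim (-(D (sphereSupport K)) * S g + D g * S (sphereSupport K)) (S (sphereSupport K))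
      fun δ hδ => by
        have := key (-(D (sphereSupport K))) (D g + δ) (by nlinarith)
        linarith
    linarith
  · have := lim (D (sphereSupport K) * S g - D g * S (sphereSupport K)) (S (sphereSupport K))
      fun δ hδ => by
        have := key (D (sphereSupport K)) (-D g + δ) (by nlinarith)
        linarith
    linarith

/-- The proportionality of functionals is an identity between `h ^ (p - 1) μ` and the curvature
measure for exponent 1, both even. The positive weight `h ^ (1 - p)` then moves to the other side.
-/
theorem smul_eq_smul_dualCurvatureMeasure (hp : 1 < p) (hq : 1 < q) (hμ : μ ≠ 0)
    (hμ_even : μ.map (fun v => -v) = μ)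
    (hK : K ∈ symmetricBodies n) (hvol : dualQuermassintegral q K = μ univ)
    (hmax : IsMaxOn (functionalPhi p μ)
      {K | K ∈ symmetricBodies n ∧ dualQuermassintegral q K = μ univ} K) :
    ENNReal.ofReal (∫ v, sphereSupport K v ∂(dualCurvatureMeasure 1 q K)) • μ =
      ENNReal.ofReal (∫ v, sphereSupport K v * sphereSupport K v ^ (p - 1) ∂μ) •
        dualCurvatureMeasure p q K := by
  have hc := continuous_sphereSupport K
  have hpos := sphereSupport_pos hK
  have hneg : Measurable fun v : sphere (0 : EuclideanSpace ℝ (Fin n)) 1 => -v :=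
    continuous_neg.measurable
  have := isFiniteMeasure_dualCurvatureMeasure 1 q hK
  have hpc : Continuous fun v => sphereSupport K v ^ (p - 1) :=
    hc.rpow_const fun v => Or.inl (hpos v).ne'
  have hpc' : Continuous fun v => sphereSupport K v ^ (1 - p) :=
    hc.rpow_const fun v => Or.inl (hpos v).ne'
  have hpm := hpc.measurable.ennreal_ofReal
  have hpm' := hpc'.measurable.ennreal_ofReal
  set a := ∫ v, sphereSupport K v ∂(dualCurvatureMeasure 1 q K) with ha
  set b := ∫ v, sphereSupport K v * sphereSupport K v ^ (p - 1) ∂μ with hb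
  have ha0 : 0 ≤ a := integral_nonneg fun v => (hpos v).le
  have hb0 : 0 ≤ b := integral_nonneg fun v => mul_nonneg (hpos v).le
    (Real.rpow_nonneg (hpos v).le _)
  set m := μ.withDensity fun v => ENNReal.ofReal (sphereSupport K v ^ (p - 1)) with hm
  have hmfin : IsFiniteMeasure m := isFiniteMeasure_withDensity_ofReal
    (hpc.integrable_of_hasCompactSupport (HasCompactSupport.of_compactSpace _)).2
  have hmeven : m.map (fun v => -v) = m := by
    have := map_withDensity_comp (M := μ) hneg hpm
    rw [hμ_even] at this
    have heq : (fun v => ENNReal.ofReal (sphereSupport K v ^ (p - 1))) ∘ (fun v => -v) =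
        fun v => ENNReal.ofReal (sphereSupport K v ^ (p - 1)) :=
      funext fun v => by simp only [Function.comp_apply, sphereSupport_neg hK]
    rwa [heq] at this
  have h1 : ENNReal.ofReal a • m = ENNReal.ofReal b • dualCurvatureMeasure 1 q K := by
    have : IsFiniteMeasure (ENNReal.ofReal a • m) := m.smul_finite ENNReal.ofReal_ne_top
    have : IsFiniteMeasure (ENNReal.ofReal b • dualCurvatureMeasure 1 q K) :=
      (dualCurvatureMeasure 1 q K).smul_finite ENNReal.ofReal_ne_top
    refine ext_of_forall_even_integral_eq ?_ ?_ fun g hg heven => ?_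
    · rw [Measure.map_smul, hmeven]
    · rw [Measure.map_smul, dualCurvatureMeasure_map_neg 1 q hK]
    · rw [integral_smul_measure, integral_smul_measure, ENNReal.toReal_ofReal ha0,
        ENNReal.toReal_ofReal hb0, smul_eq_mul, smul_eq_mul,
        ← integral_mul_eq_integral_mul hp hq hμ hK hvol hmax hg heven, hm,
        integral_withDensity_eq_integral_toReal_smul hpm
          (ae_of_all _ fun _ => ENNReal.ofReal_lt_top)]
      congr 1
      refine integral_congr_ae (ae_of_all _ fun v => ?_)
      simp only [ENNReal.toReal_ofReal (Real.rpow_nonneg (hpos v).le _), smul_eq_mul, mul_comm]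
  have h2 : m.withDensity (fun v => ENNReal.ofReal (sphereSupport K v ^ (1 - p))) = μ := by
    rw [hm, ← withDensity_mul _ hpm hpm']
    have : (fun v => ENNReal.ofReal (sphereSupport K v ^ (p - 1))) *
        (fun v => ENNReal.ofReal (sphereSupport K v ^ (1 - p))) = 1 := by
      funext v
      rw [Pi.mul_apply, ← ENNReal.ofReal_mul (Real.rpow_nonneg (hpos v).le _),
        ← Real.rpow_add (hpos v)]
      simp
    rw [this, withDensity_one]
  rw [← dualCurvatureMeasure_withDensity p q hK, ← withDensity_smul_measure, ← h1,
    withDensity_smul_measure, h2]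

end Maximizer

end GaussianDual

theorem theorem4p1 (n : ℕ) (p q : ℝ) (hp : 1 < p) (hq : 1 < q)
    (μ : Measure (Metric.sphere (0 : EuclideanSpace ℝ (Fin n)) 1)) [IsFiniteMeasure μ]
    (hμ : μ ≠ 0) (hμ_even : μ.map (fun v => -v) = μ)
    (K₀ : ConvexBody (EuclideanSpace ℝ (Fin n)))
    (hK₀ : K₀ ∈ GaussianDual.symmetricBodies n)
    (hvol : GaussianDual.dualQuermassintegral q K₀ = μ Set.univ)
    (hmax : IsMaxOn (GaussianDual.functionalPhi p μ)
      {K | K ∈ GaussianDual.symmetricBodies n ∧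
        GaussianDual.dualQuermassintegral q K = μ Set.univ} K₀) :
    (μ Set.univ)⁻¹ • μ =
      (GaussianDual.dualCurvatureMeasure p q K₀ Set.univ)⁻¹ •
        GaussianDual.dualCurvatureMeasure p q K₀ := by
  -- This excludes `n = 0`, where the unit sphere is empty and carries no nonzero measure.
  have : Nonempty (Metric.sphere (0 : EuclideanSpace ℝ (Fin n)) 1) := by
    by_contra h
    rw [not_nonempty_iff] at h
    exact hμ (Measure.eq_zero_of_isEmpty μ)
  have hc := GaussianDual.continuous_sphereSupport K₀
  have hpos := GaussianDual.sphereSupport_pos hK₀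
  have := GaussianDual.isFiniteMeasure_dualCurvatureMeasure 1 q hK₀
  have ha := GaussianDual.integral_pos_of_continuous_pos
    (GaussianDual.dualCurvatureMeasure_ne_zero 1 q hK₀) hc hpos
  have hb := GaussianDual.integral_pos_of_continuous_pos hμ
    (hc.mul (hc.rpow_const fun v => Or.inl (hpos v).ne'))
    fun v => mul_pos (hpos v) (Real.rpow_pos_of_pos (hpos v) (p - 1))
  exact GaussianDual.inv_measure_univ_smul_eq (ENNReal.ofReal_pos.2 ha).ne' ENNReal.ofReal_ne_top
    (ENNReal.ofReal_pos.2 hb).ne' ENNReal.ofReal_ne_top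
    (GaussianDual.smul_eq_smul_dualCurvatureMeasure hp hq hμ hμ_even hK₀ hvol hmax)
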